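/- **Conventions.** Let $(e_i)$ be the standard basis of $\mathbb R^n$ and $(f_i)$ its dual basis. For $I\subseteq\{1,\dots,n\}$ with complement $I'$, let $\mathbb R^{I'}=\operatorname{span}\{e_i: i\in I'\}$. Equip $\mathbb R^n\oplus(\mathbb R^n)^*$ with $\langle X_1+\xi_1,X_2+\xi_2\rangle=\tfrac12(\xi_1(X_2)+\xi_2(X_1))$. A constant Dirac structure on $\mathbb T^n=\mathbb R^n/\mathbb Z^n$ is a maximal isotropic subspace $\Gamma$ of $\mathbb R^n\oplus(\mathbb R^n)^*$; its characteristic subspace is $C(\Gamma)=\Gamma\cap\mathbb R^n$. A constant Poisson structure is a skew-symmetric real $n\times n$ matrix $\Pi$; it is identified with the Dirac structure $\Gamma_\Pi=\{(\Pi\xi,\xi):\xi\in(\mathbb R^n)^*\}$. Let $\sigma_I$ be the linear automorphism of $\mathbb R^n\oplus(\mathbb R^n)^*$ that exchanges $e_i$ and $f_i$ for $i\in I$ and fixes the other basis vectors. For a finite set $J$ and a skew-symmetric $J\times J$ matrix $\Pi$, the quantum torus algebra $\mathcal A_\Pi$ is the universal $C^*$-completion of the algebra of finite Fourier series on $\mathbb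 T^J$ with the product $e_r*e_s=e^{-\pi i\,\Pi(r,s)}e_{r+s}$ and the involution $e_r^*=e_{-r}$, where $e_r(x)=e^{2\pi i\, r\cdot x}$ and $\Pi(r,s)=\sum_{i,j}r_i\Pi_{ij}s_j$ for $r,s\in\mathbb Z^J$. The torus $\mathbb T^J$ acts on it by translations, $\tau_t(e_r)=e^{-2\pi i\, r\cdot t}e_r$. Suppose $\mathbb R^{I'}$ is complementary to $C(\Gamma)$, and let $M=\mathbb T^{I'}$. Let $\Pi_{\Gamma,M}$ be the Poisson structure on $M$ obtained, through the isomorphism $\mathbb R^n/C(\Gamma)\cong\mathbb R^{I'}$, from the natural bivector of $\Gamma$ on $\mathbb R^n/C(\Gamma)$, whose value at covectors $\xi,\eta$ of the quotient (that is, covectors of $\mathbb R^n$ that annihilate $C(\Gamma)$) is $\xi(X)$ for any $X$ with $(X,\eta)\in\Gamma$. Let $\beta:\mathbb R^I\to\mathbb R^{I'}$ be the linear map whose graph is $C(\Gamma)$. The lattice $\mathbb Z^I$ acts on $M$ by the translations $\beta(m)\bmod\mathbb Z^{I'}$, hence on $\mathcal A_{\Pi_{\Gamma,M}}$ through $\tau$.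 Let $\mathcal A_{\Gamma,M}=\mathcal A_{\Pi_{\Gamma,M}}\rtimes\mathbb Z^I$ be the crossed product $C^*$-algebra. **Proposition.** Let $\Gamma$ be a constant Dirac structure on $\mathbb T^n$ and let $I\subseteq\{1,\dots,n\}$ be such that the coordinate subspace $\mathbb R^{I'}$ is complementary to the characteristic subspace $C(\Gamma)$. Then $\sigma_I(\Gamma)$ is a Poisson structure, i.e. $\sigma_I(\Gamma)=\Gamma_\Pi$ for a (unique) skew-symmetric real matrix $\Pi$, and the crossed product algebra $\mathcal A_{\Gamma,M}$, $M=\mathbb T^{I'}$, is $*$-isomorphic to the quantum torus algebra $\mathcal A_{\sigma_I(\Gamma)}:=\mathcal A_\Pi$. -/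

import Mathlib

noncomputable section

namespace DiracQuant

open UniformSpace

/-! ## Universal C⋆-algebras -/

/-- A C⋆-seminorm on a unital complex ⋆-algebra: a submultiplicative seminorm satisfying the
C⋆-identity. -/
structure CStarSeminorm (B : Type*) [Ring B] [StarRing B] [Algebra ℂ B] [StarModule ℂ B]
    extends Seminorm ℂ B where
  mul_le' : ∀ x y : B, toFun (x * y) ≤ toFun x * toFun y
  star_mul_self' : ∀ x : B, toFun (star x * x) = toFun x ^ 2

namespace CStarSeminorm

section

variable {B : Type*} [Ring B] [StarRing B] [Algebra ℂ B] [StarModule ℂ B]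

theorem mul_le (p : CStarSeminorm B) (x y : B) :
    p.toSeminorm (x * y) ≤ p.toSeminorm x * p.toSeminorm y := p.mul_le' x y

theorem star_mul_self (p : CStarSeminorm B) (x : B) :
    p.toSeminorm (star x * x) = p.toSeminorm x ^ 2 := p.star_mul_self' x

theorem le_star (p : CStarSeminorm B) (x : B) : p.toSeminorm x ≤ p.toSeminorm (star x) := by
  have h1 := p.mul_le (star x) x
  rw [p.star_mul_self x, sq] at h1
  rcases (apply_nonneg p.toSeminorm x).eq_or_lt with h | h
  · rw [← h]; exact apply_nonneg _ _
  · exact le_of_mul_le_mul_right h1 h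

theorem map_star (p : CStarSeminorm B) (x : B) : p.toSeminorm (star x) = p.toSeminorm x := by
  refine le_antisymm ?_ (p.le_star x)
  simpa using p.le_star (star x)

/-- If `star x * x = 1`, then every C⋆-seminorm is at most one at `x`. -/
theorem le_one_of_isometry (p : CStarSeminorm B) {x : B} (hx : star x * x = 1) :
    p.toSeminorm x ≤ 1 := by
  have h1 : p.toSeminorm (1 : B) ≤ 1 := by
    have h := p.star_mul_self (1 : B)
    rw [star_one, one_mul] at h
    nlinarith [apply_nonneg p.toSeminorm (1 : B)]
  have h := p.star_mul_self x
  rw [hx] at h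
  nlinarith [apply_nonneg p.toSeminorm x]

/-- The zero C⋆-seminorm. -/
instance : Inhabited (CStarSeminorm B) :=
  ⟨{ (0 : Seminorm ℂ B) with
      mul_le' := fun x y => by
        change (0 : ℝ) ≤ 0 * 0
        simp
      star_mul_self' := fun x => by
        change (0 : ℝ) = 0 ^ 2
        simp }⟩

/-- The pull-back of a C⋆-seminorm along a ⋆-homomorphism. -/
def comap {B' : Type*} [Ring B'] [StarRing B'] [Algebra ℂ B'] [StarModule ℂ B']
    (p : CStarSeminorm B') (φ : B →⋆ₐ[ℂ] B') : CStarSeminorm B :=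
  { p.toSeminorm.comp (φ : B →ₐ[ℂ] B').toLinearMap with
    mul_le' := fun x y => by
      change p.toSeminorm (φ (x * y)) ≤ p.toSeminorm (φ x) * p.toSeminorm (φ y)
      rw [map_mul]
      exact p.mul_le _ _
    star_mul_self' := fun x => by
      change p.toSeminorm (φ (star x * x)) = p.toSeminorm (φ x) ^ 2
      rw [_root_.map_mul, StarHomClass.map_star]
      exact p.star_mul_self _ }

/-- The ⋆-algebra `B`, regarded as a seminormed algebra by means of `p`. -/
@[nolint unusedArguments]
def Pre (_p : CStarSeminorm B) : Type _ := B

variable (p : CStarSeminorm B)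

instance : Ring p.Pre := inferInstanceAs (Ring B)
instance : StarRing p.Pre := inferInstanceAs (StarRing B)
instance : Algebra ℂ p.Pre := inferInstanceAs (Algebra ℂ B)
instance : StarModule ℂ p.Pre := inferInstanceAs (StarModule ℂ B)

instance : SeminormedRing p.Pre :=
  { (inferInstance : Ring p.Pre),
    p.toSeminorm.toSeminormedAddCommGroup with
    norm_mul_le := p.mul_le' }

theorem norm_pre (x : p.Pre) : ‖x‖ = p.toSeminorm x := rfl

instance : NormedAlgebra ℂ p.Pre where
  norm_smul_le a x := le_of_eq (map_smul_eq_mul p.toSeminorm a x)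

instance : NormedStarGroup p.Pre where
  norm_star_le x := le_of_eq (p.map_star x)

/-- The C⋆-algebra obtained from `B` by dividing out the kernel of the C⋆-seminorm `p` and
completing. -/
def Completed : Type _ := Completion p.Pre

instance : NormedRing p.Completed := inferInstanceAs (NormedRing (Completion p.Pre))
instance : CompleteSpace p.Completed := inferInstanceAs (CompleteSpace (Completion p.Pre))
instance : Algebra ℂ p.Completed := inferInstanceAs (Algebra ℂ (Completion p.Pre))

/-- The canonical map from `B` to the completion. -/
def coe (x : B) : p.Completed := ((show p.Pre from x : p.Pre) : Completion p.Pre)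

theorem norm_coe (x : B) : ‖p.coe x‖ = p.toSeminorm x := Completion.norm_coe (E := p.Pre) x

theorem coe_add (x y : B) : p.coe (x + y) = p.coe x + p.coe y :=
  Completion.coe_add (α := p.Pre) x y

theorem coe_mul (x y : B) : p.coe (x * y) = p.coe x * p.coe y :=
  Completion.coe_mul (α := p.Pre) x y

theorem coe_one : p.coe 1 = 1 := Completion.coe_one (α := p.Pre)

theorem coe_smul (c : ℂ) (x : B) : p.coe (c • x) = c • p.coe x :=
  Completion.coe_smul (X := p.Pre) c x

theorem dense_coe : DenseRange p.coe := Completion.denseRange_coe (α := p.Pre)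

instance : NormedAlgebra ℂ p.Completed where
  norm_smul_le := norm_smul_le (α := ℂ) (β := Completion p.Pre)

instance : Star p.Completed := ⟨Completion.map (star : p.Pre → p.Pre)⟩

theorem uniformContinuous_star : UniformContinuous (star : p.Pre → p.Pre) :=
  (AddMonoidHomClass.isometry_of_norm (starAddEquiv (R := p.Pre)) norm_star).uniformContinuous

theorem star_coe (x : B) : star (p.coe x) = p.coe (star x) :=
  Completion.map_coe p.uniformContinuous_star x

theorem continuous_star' : Continuous (star : p.Completed → p.Completed) :=
  Completion.continuous_map

/-- The C⋆-algebra structure on the completion; all operations extend those of `B`. -/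
instance : CStarAlgebra p.Completed where
  star_involutive x := by
    refine p.dense_coe.induction_on x ?_ ?_
    · exact isClosed_eq (p.continuous_star'.comp p.continuous_star') continuous_id
    · intro a; rw [star_coe, star_coe, star_star]
  star_mul x y := by
    refine p.dense_coe.induction_on₂ ?_ ?_ x y
    · exact isClosed_eq (p.continuous_star'.comp continuous_mul)
        ((p.continuous_star'.comp continuous_snd).mul (p.continuous_star'.comp continuous_fst))
    · intro a b; rw [← coe_mul, star_coe, star_coe, star_coe, star_mul, coe_mul]
  star_add x y := by
    refine p.dense_coe.induction_on₂ ?_ ?_ x y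
    · exact isClosed_eq (p.continuous_star'.comp continuous_add)
        ((p.continuous_star'.comp continuous_fst).add (p.continuous_star'.comp continuous_snd))
    · intro a b; rw [← coe_add, star_coe, star_coe, star_coe, star_add, coe_add]
  norm_mul_self_le x := by
    refine p.dense_coe.induction_on x ?_ ?_
    · exact isClosed_le (continuous_norm.mul continuous_norm)
        (continuous_norm.comp (p.continuous_star'.mul continuous_id))
    · intro a
      rw [star_coe, ← coe_mul, norm_coe, norm_coe, p.star_mul_self, sq]
  star_smul c x := by
    refine p.dense_coe.induction_on x ?_ ?_
    · exact isClosed_eq (p.continuous_star'.comp (continuous_const_smul c))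
        (p.continuous_star'.const_smul (star c))
    · intro a; rw [← coe_smul, star_coe, star_coe, star_smul, coe_smul]

/-- The canonical ⋆-homomorphism from `B` to the completion. -/
def of : B →⋆ₐ[ℂ] p.Completed where
  toFun := p.coe
  map_one' := p.coe_one
  map_mul' := p.coe_mul
  map_zero' := Completion.coe_zero (α := p.Pre)
  map_add' := p.coe_add
  commutes' c := by
    change p.coe (algebraMap ℂ B c) = algebraMap ℂ p.Completed c
    rw [Algebra.algebraMap_eq_smul_one, Algebra.algebraMap_eq_smul_one, coe_smul, coe_one]
  map_star' x := (p.star_coe x).symm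

/-- A C⋆-seminorm composed with a ⋆-homomorphism out of a C⋆-algebra is dominated by the norm. -/
theorem apply_le_norm {A : Type*} [CStarAlgebra A] (φ : A →⋆ₙₐ[ℂ] B) (a : A) :
    p.toSeminorm (φ a) ≤ ‖a‖ := by
  rw [← norm_coe]
  exact NonUnitalStarAlgHom.norm_apply_le ((p.of : B →⋆ₙₐ[ℂ] p.Completed).comp φ) a

end

end CStarSeminorm

/-- The ⋆-algebra `B` has a universal C⋆-algebra: at each element the C⋆-seminorms are bounded. -/
class HasUniversalCStar (B : Type*) [Ring B] [StarRing B] [Algebra ℂ B] [StarModule ℂ B] :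
    Prop where
  bounded : ∀ x : B, ∃ K : ℝ, ∀ p : CStarSeminorm B, p.toSeminorm x ≤ K

section Universal

universe u

variable (B : Type u) [Ring B] [StarRing B] [Algebra ℂ B] [StarModule ℂ B] [HasUniversalCStar B]

variable {B} in
theorem bddAbove_seminorm (x : B) :
    BddAbove (Set.range fun p : CStarSeminorm B => p.toSeminorm x) := by
  obtain ⟨K, hK⟩ := HasUniversalCStar.bounded x
  exact ⟨K, by rintro _ ⟨p, rfl⟩; exact hK p⟩

/-- The greatest C⋆-seminorm, the pointwise supremum of all C⋆-seminorms on `B`. -/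
def universalSeminorm : CStarSeminorm B where
  toFun x := ⨆ p : CStarSeminorm B, p.toSeminorm x
  map_zero' := by simp
  add_le' x y := ciSup_le fun p => (map_add_le_add p.toSeminorm x y).trans
    (add_le_add (le_ciSup (bddAbove_seminorm x) p) (le_ciSup (bddAbove_seminorm y) p))
  neg' x := by simp
  smul' c x := by
    simp only [map_smul_eq_mul]
    rw [Real.mul_iSup_of_nonneg (norm_nonneg c)]
  mul_le' x y := ciSup_le fun p => (p.mul_le x y).trans
    (mul_le_mul (le_ciSup (bddAbove_seminorm x) p) (le_ciSup (bddAbove_seminorm y) p)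
      (apply_nonneg _ _) (Real.iSup_nonneg fun p => apply_nonneg p.toSeminorm x))
  star_mul_self' x := by
    have h0 : 0 ≤ ⨆ p : CStarSeminorm B, p.toSeminorm x :=
      Real.iSup_nonneg fun p => apply_nonneg p.toSeminorm x
    have h1 : 0 ≤ ⨆ p : CStarSeminorm B, p.toSeminorm (star x * x) :=
      Real.iSup_nonneg fun p => apply_nonneg p.toSeminorm _
    apply le_antisymm
    · refine ciSup_le fun p => ?_
      rw [p.star_mul_self]
      exact pow_le_pow_left₀ (apply_nonneg _ _) (le_ciSup (bddAbove_seminorm x) p) 2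
    · rw [← Real.le_sqrt h0 h1]
      refine ciSup_le fun p => ?_
      rw [Real.le_sqrt (apply_nonneg _ _) h1, ← p.star_mul_self]
      exact le_ciSup (bddAbove_seminorm (star x * x)) p

theorem le_universalSeminorm (p : CStarSeminorm B) (x : B) :
    p.toSeminorm x ≤ (universalSeminorm B).toSeminorm x :=
  le_ciSup (bddAbove_seminorm x) p

/-- The universal (enveloping) C⋆-algebra of the ⋆-algebra `B`: the completion of `B` with respect
to the greatest C⋆-seminorm. -/
abbrev UniversalCStar : Type u := (universalSeminorm B).Completed

variable {B} {B' : Type u} [Ring B'] [StarRing B'] [Algebra ℂ B'] [StarModule ℂ B']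
  [HasUniversalCStar B']

/-- The canonical ⋆-homomorphism from `B` into its universal C⋆-algebra. -/
def toUniversal : B →⋆ₐ[ℂ] UniversalCStar B := (universalSeminorm B).of

theorem dense_toUniversal : DenseRange (toUniversal : B → UniversalCStar B) :=
  (universalSeminorm B).dense_coe

theorem continuous_comp_toUniversal (φ : B →⋆ₐ[ℂ] B') :
    Continuous (fun x : (universalSeminorm B).Pre => toUniversal (φ x)) := by
  let f : (universalSeminorm B).Pre →+ UniversalCStar B' :=
    AddMonoidHom.mk' (fun x => toUniversal (φ x)) fun x y =>
      map_add ((toUniversal : B' →⋆ₐ[ℂ] UniversalCStar B').comp φ) (x : B) (y : B)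
  refine AddMonoidHomClass.continuous_of_bound f 1 fun x => ?_
  rw [one_mul]
  change ‖(universalSeminorm B').coe (φ x)‖ ≤ _
  rw [CStarSeminorm.norm_coe]
  exact le_universalSeminorm B ((universalSeminorm B').comap φ) x

/-- The underlying ring homomorphism of `universalMap`. -/
def universalMapRing (φ : B →⋆ₐ[ℂ] B') : UniversalCStar B →+* UniversalCStar B' :=
  Completion.extensionHom (α := (universalSeminorm B).Pre)
    (((toUniversal.comp φ : B →⋆ₐ[ℂ] UniversalCStar B') : B →+* UniversalCStar B') :
      (universalSeminorm B).Pre →+* UniversalCStar B') (continuous_comp_toUniversal φ)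

theorem universalMapRing_apply (φ : B →⋆ₐ[ℂ] B') (x : B) :
    universalMapRing φ (toUniversal x) = toUniversal (φ x) :=
  Completion.extensionHom_coe (α := (universalSeminorm B).Pre) _ (continuous_comp_toUniversal φ) x

theorem continuous_universalMapRing (φ : B →⋆ₐ[ℂ] B') : Continuous (universalMapRing φ) :=
  Completion.continuous_extension (α := (universalSeminorm B).Pre)

/-- Functoriality: the extension of a ⋆-homomorphism `B → B'` to the universal C⋆-algebras. -/
def universalMap (φ : B →⋆ₐ[ℂ] B') : UniversalCStar B →⋆ₐ[ℂ] UniversalCStar B' :=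
  { universalMapRing φ with
    commutes' := fun c => by
      change universalMapRing φ (algebraMap ℂ _ c) = _
      rw [← AlgHomClass.commutes (toUniversal : B →⋆ₐ[ℂ] UniversalCStar B) c,
        universalMapRing_apply, AlgHomClass.commutes, AlgHomClass.commutes]
    map_star' := fun x => by
      change universalMapRing φ (star x) = star (universalMapRing φ x)
      refine dense_toUniversal.induction_on x ?_ ?_
      · exact isClosed_eq ((continuous_universalMapRing φ).comp continuous_star)
          (continuous_star.comp (continuous_universalMapRing φ))
      · intro a
        rw [← map_star, universalMapRing_apply, universalMapRing_apply, map_star, map_star] }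

theorem universalMap_apply (φ : B →⋆ₐ[ℂ] B') (x : B) :
    universalMap φ (toUniversal x) = toUniversal (φ x) := universalMapRing_apply φ x

theorem continuous_universalMap (φ : B →⋆ₐ[ℂ] B') : Continuous (universalMap φ) :=
  continuous_universalMapRing φ

/-- Two ⋆-endomorphisms of `B` inverse to each other give a ⋆-automorphism of the universal
C⋆-algebra. -/
def universalEquiv (φ ψ : B →⋆ₐ[ℂ] B) (h₁ : ∀ x, ψ (φ x) = x) (h₂ : ∀ x, φ (ψ x) = x) :
    UniversalCStar B ≃⋆ₐ[ℂ] UniversalCStar B :=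
  StarAlgEquiv.ofBijective (universalMap φ) <| by
    have aux : ∀ φ ψ : B →⋆ₐ[ℂ] B, (∀ x, ψ (φ x) = x) →
        Function.LeftInverse (universalMap ψ) (universalMap φ) := by
      intro φ ψ h x
      refine dense_toUniversal.induction_on x ?_ ?_
      · exact isClosed_eq ((continuous_universalMap ψ).comp (continuous_universalMap φ))
          continuous_id
      · intro a
        rw [universalMap_apply, universalMap_apply, h]
    exact ⟨(aux φ ψ h₁).injective, (aux ψ φ h₂).surjective⟩

theorem universalEquiv_apply (φ ψ : B →⋆ₐ[ℂ] B) (h₁ : ∀ x, ψ (φ x) = x)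
    (h₂ : ∀ x, φ (ψ x) = x) (x : UniversalCStar B) :
    universalEquiv φ ψ h₁ h₂ x = universalMap φ x := rfl

end Universal

/-! ## The quantum torus algebra -/

section QuantumTorus

set_option linter.unusedSectionVars false

/-- A constant Poisson structure on the torus `𝕋^J = ℝ^J / ℤ^J`: a skew-symmetric real matrix. -/
@[ext]
structure PoissonTensor (J : Type) where
  matrix : Matrix J J ℝ
  skew : matrix.transpose = -matrix

variable {J : Type} [Fintype J]

namespace PoissonTensor

/-- The skew-symmetric bilinear form `Π(r, s) = ∑ i j, r_i Π_ij s_j` on multi-indices. -/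
def form (P : PoissonTensor J) (r s : J → ℤ) : ℝ :=
  (fun i => (r i : ℝ)) ⬝ᵥ P.matrix.mulVec (fun j => (s j : ℝ))

theorem form_add_left (P : PoissonTensor J) (r r' s : J → ℤ) :
    P.form (r + r') s = P.form r s + P.form r' s := by
  simp only [form, ← add_dotProduct]
  congr 1
  ext i
  simp

theorem form_add_right (P : PoissonTensor J) (r s s' : J → ℤ) :
    P.form r (s + s') = P.form r s + P.form r s' := by
  simp only [form, ← dotProduct_add, ← Matrix.mulVec_add]
  congr 2
  ext i
  simp

theorem form_swap (P : PoissonTensor J) (r s : J → ℤ) : P.form s r = -P.form r s := by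
  simp only [form]
  rw [Matrix.dotProduct_mulVec, ← Matrix.mulVec_transpose, P.skew, Matrix.neg_mulVec,
    neg_dotProduct, dotProduct_comm]

/-- The twisting factor `e^{-π i Π(r,s)}`. -/
def twist (P : PoissonTensor J) (r s : J → ℤ) : ℂ :=
  Complex.exp (-(Real.pi * Complex.I * (P.form r s : ℂ)))

theorem twist_add_left (P : PoissonTensor J) (r r' s : J → ℤ) :
    P.twist (r + r') s = P.twist r s * P.twist r' s := by
  rw [twist, twist, twist, ← Complex.exp_add, form_add_left]
  push_cast
  ring_nf

theorem twist_add_right (P : PoissonTensor J) (r s s' : J → ℤ) :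
    P.twist r (s + s') = P.twist r s * P.twist r s' := by
  rw [twist, twist, twist, ← Complex.exp_add, form_add_right]
  push_cast
  ring_nf

theorem form_zero_left (P : PoissonTensor J) (s : J → ℤ) : P.form 0 s = 0 := by
  have := P.form_add_left 0 0 s
  simpa using this

theorem form_zero_right (P : PoissonTensor J) (s : J → ℤ) : P.form s 0 = 0 := by
  have := P.form_add_right s 0 0
  simpa using this

theorem twist_zero_left (P : PoissonTensor J) (s : J → ℤ) : P.twist 0 s = 1 := by
  simp [twist, form_zero_left]

theorem twist_zero_right (P : PoissonTensor J) (s : J → ℤ) : P.twist s 0 = 1 := by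
  simp [twist, form_zero_right]

theorem form_neg_neg (P : PoissonTensor J) (r s : J → ℤ) : P.form (-r) (-s) = P.form r s := by
  have h1 := P.form_add_left (-r) r (-s)
  have h2 := P.form_add_right r (-s) s
  simp only [neg_add_cancel, form_zero_left, form_zero_right] at h1 h2
  linarith

theorem star_twist (P : PoissonTensor J) (r s : J → ℤ) :
    star (P.twist r s) = P.twist (-s) (-r) := by
  rw [twist, twist, form_neg_neg, form_swap P r s, Complex.star_def, ← Complex.exp_conj]
  simp

theorem twist_neg_self (P : PoissonTensor J) (r : J → ℤ) : P.twist (-r) r = 1 := by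
  have h : P.form r r = 0 := by
    have := P.form_swap r r
    linarith
  have h1 := P.form_add_left (-r) r r
  rw [neg_add_cancel, form_zero_left, h, add_zero] at h1
  simp [twist, ← h1]

end PoissonTensor

/-- Finite Fourier series `∑ a_r e_r` on the torus `𝕋^J`; below they carry the twisted product
determined by the Poisson structure `P`. -/
@[nolint unusedArguments]
def FourierPoly (_P : PoissonTensor J) : Type := (J → ℤ) →₀ ℂ

namespace FourierPoly

variable (P : PoissonTensor J)

instance : AddCommGroup (FourierPoly P) := inferInstanceAs (AddCommGroup ((J → ℤ) →₀ ℂ))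
instance : Module ℂ (FourierPoly P) := inferInstanceAs (Module ℂ ((J → ℤ) →₀ ℂ))

/-- The monomial `a e_r`. -/
def mono (r : J → ℤ) (a : ℂ) : FourierPoly P := Finsupp.single r a

variable {P}

theorem mono_add (r : J → ℤ) (a b : ℂ) : mono P r (a + b) = mono P r a + mono P r b :=
  Finsupp.single_add r a b

theorem mono_zero (r : J → ℤ) : mono P r 0 = 0 := Finsupp.single_zero r

theorem smul_mono (c : ℂ) (r : J → ℤ) (a : ℂ) : c • mono P r a = mono P r (c * a) :=
  Finsupp.smul_single c r a

@[elab_as_elim]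
theorem induction {p : FourierPoly P → Prop} (f : FourierPoly P) (zero : p 0)
    (add : ∀ f g, p f → p g → p (f + g)) (mono : ∀ r a, p (mono P r a)) : p f :=
  Finsupp.induction_linear f zero add mono

/-- The additive map with prescribed values on monomials. -/
def sumHom {N : Type*} [AddCommGroup N] (F : (J → ℤ) → ℂ →+ N) : FourierPoly P →+ N :=
  Finsupp.liftAddHom F

theorem sumHom_mono {N : Type*} [AddCommGroup N] (F : (J → ℤ) → ℂ →+ N) (r : J → ℤ) (a : ℂ) :
    sumHom F (mono P r a) = F r a :=
  Finsupp.liftAddHom_apply_single F r a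

/-- The twisted product as a biadditive map, `(a e_r) (b e_s) = a b e^{-π i Π(r,s)} e_{r+s}`. -/
def mulHom : FourierPoly P →+ FourierPoly P →+ FourierPoly P :=
  sumHom fun r => AddMonoidHom.mk' (fun a => sumHom fun s => AddMonoidHom.mk'
      (fun b => mono P (r + s) (a * b * P.twist r s))
      fun b b' => by rw [← mono_add]; ring_nf)
    fun a a' => by
      refine AddMonoidHom.ext fun f => f.induction (by simp) (fun f g hf hg => ?_) fun s b => ?_
      · rw [map_add, map_add, hf, hg]
      · rw [AddMonoidHom.add_apply, sumHom_mono, sumHom_mono, sumHom_mono]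
        simp only [AddMonoidHom.mk'_apply]
        rw [← mono_add]
        ring_nf

instance : Mul (FourierPoly P) := ⟨fun f g => mulHom f g⟩
instance : One (FourierPoly P) := ⟨mono P 0 1⟩

theorem one_def : (1 : FourierPoly P) = mono P 0 1 := rfl

theorem mono_mul_mono (r s : J → ℤ) (a b : ℂ) :
    mono P r a * mono P s b = mono P (r + s) (a * b * P.twist r s) := by
  change mulHom (mono P r a) (mono P s b) = _
  rw [mulHom, sumHom_mono, AddMonoidHom.mk'_apply, sumHom_mono, AddMonoidHom.mk'_apply]

theorem mul_add' (f g h : FourierPoly P) : f * (g + h) = f * g + f * h :=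
  map_add (mulHom f) g h

theorem add_mul' (f g h : FourierPoly P) : (f + g) * h = f * h + g * h := by
  change mulHom (f + g) h = mulHom f h + mulHom g h
  rw [map_add, AddMonoidHom.add_apply]

theorem zero_mul' (f : FourierPoly P) : 0 * f = 0 := by
  change mulHom 0 f = 0
  simp

theorem mul_zero' (f : FourierPoly P) : f * 0 = 0 := map_zero (mulHom f)

instance : Ring (FourierPoly P) :=
  { (inferInstance : AddCommGroup (FourierPoly P)) with
    mul := (· * ·)
    one := 1
    left_distrib := mul_add'
    right_distrib := add_mul'
    zero_mul := zero_mul'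
    mul_zero := mul_zero'
    mul_assoc := fun f g h => by
      refine f.induction (by simp only [zero_mul']) (fun _ _ h₁ h₂ => ?_) fun r a => ?_
      · simp only [add_mul', h₁, h₂]
      refine g.induction (by simp only [zero_mul', mul_zero']) (fun _ _ h₁ h₂ => ?_) fun s b => ?_
      · simp only [add_mul', mul_add', h₁, h₂]
      refine h.induction (by simp only [mul_zero']) (fun _ _ h₁ h₂ => ?_) fun t c => ?_
      · simp only [mul_add', h₁, h₂]
      rw [mono_mul_mono, mono_mul_mono, mono_mul_mono, mono_mul_mono, add_assoc,
        P.twist_add_left, P.twist_add_right]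
      ring_nf
    one_mul := fun f => by
      refine f.induction (mul_zero' _) (fun _ _ h₁ h₂ => ?_) fun r a => ?_
      · rw [mul_add', h₁, h₂]
      · rw [one_def, mono_mul_mono, P.twist_zero_left, zero_add, one_mul, mul_one]
    mul_one := fun f => by
      refine f.induction (zero_mul' _) (fun _ _ h₁ h₂ => ?_) fun r a => ?_
      · rw [add_mul', h₁, h₂]
      · rw [one_def, mono_mul_mono, P.twist_zero_right, add_zero, mul_one, mul_one] }

instance : Algebra ℂ (FourierPoly P) :=
  Algebra.ofModule
    (fun c f g => by
      refine f.induction (by simp) (fun _ _ h₁ h₂ => ?_) fun r a => ?_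
      · rw [smul_add, add_mul, add_mul, h₁, h₂, smul_add]
      refine g.induction (by simp) (fun _ _ h₁ h₂ => ?_) fun s b => ?_
      · rw [mul_add, mul_add, h₁, h₂, smul_add]
      rw [smul_mono, mono_mul_mono, mono_mul_mono, smul_mono]
      ring_nf)
    (fun c f g => by
      refine f.induction (by simp) (fun _ _ h₁ h₂ => ?_) fun r a => ?_
      · rw [add_mul, add_mul, h₁, h₂, smul_add]
      refine g.induction (by simp) (fun _ _ h₁ h₂ => ?_) fun s b => ?_
      · rw [smul_add, mul_add, mul_add, h₁, h₂, smul_add]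
      rw [smul_mono, mono_mul_mono, mono_mul_mono, smul_mono]
      ring_nf)

/-- The involution (complex conjugation of functions), `(a e_r)⋆ = conj a e_{-r}`. -/
def starHom : FourierPoly P →+ FourierPoly P :=
  sumHom fun r => AddMonoidHom.mk' (fun a => mono P (-r) (star a)) fun a b => by
    rw [star_add, mono_add]

instance : Star (FourierPoly P) := ⟨starHom⟩

theorem star_mono (r : J → ℤ) (a : ℂ) : star (mono P r a) = mono P (-r) (star a) := by
  change starHom (mono P r a) = _
  rw [starHom, sumHom_mono, AddMonoidHom.mk'_apply]

theorem star_add' (f g : FourierPoly P) : star (f + g) = star f + star g :=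
  map_add starHom f g

theorem star_zero' : star (0 : FourierPoly P) = 0 := map_zero starHom

instance : StarRing (FourierPoly P) where
  star_involutive f := by
    refine f.induction (by rw [star_zero', star_zero']) (fun _ _ h₁ h₂ => ?_) fun r a => ?_
    · rw [star_add', star_add', h₁, h₂]
    · rw [star_mono, star_mono, neg_neg, star_star]
  star_add := star_add'
  star_mul f g := by
    refine f.induction (by simp [star_zero']) (fun _ _ h₁ h₂ => ?_) fun r a => ?_
    · rw [add_mul, star_add', star_add', mul_add, h₁, h₂]
    refine g.induction (by simp [star_zero']) (fun _ _ h₁ h₂ => ?_) fun s b => ?_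
    · rw [mul_add, star_add', star_add', add_mul, h₁, h₂]
    rw [mono_mul_mono, star_mono, star_mono, star_mono, mono_mul_mono, star_mul, star_mul,
      P.star_twist, neg_add_rev]
    ring_nf

instance : StarModule ℂ (FourierPoly P) where
  star_smul c f := by
    refine f.induction (by simp) (fun _ _ h₁ h₂ => ?_) fun r a => ?_
    · rw [smul_add, star_add, star_add, smul_add, h₁, h₂]
    · rw [smul_mono, star_mono, star_mono, smul_mono, star_mul, mul_comm]

theorem star_mul_mono (r : J → ℤ) : star (mono P r 1) * mono P r 1 = 1 := by
  rw [star_mono, mono_mul_mono, P.twist_neg_self, star_one, one_def, neg_add_cancel, mul_one,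
    mul_one]

instance : HasUniversalCStar (FourierPoly P) where
  bounded f := by
    refine f.induction ⟨0, fun p => (map_zero p.toSeminorm).le⟩ ?_ ?_
    · rintro f g ⟨K, hK⟩ ⟨L, hL⟩
      exact ⟨K + L, fun p => (map_add_le_add p.toSeminorm f g).trans (add_le_add (hK p) (hL p))⟩
    · intro r a
      refine ⟨‖a‖, fun p => ?_⟩
      have h : mono P r a = a • mono P r 1 := by rw [smul_mono, mul_one]
      rw [h, map_smul_eq_mul]
      exact mul_le_of_le_one_right (norm_nonneg a) (p.le_one_of_isometry (star_mul_mono r))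

/-- Translation by `t ∈ 𝕋^J` of finite Fourier series, `(τ_t f)(x) = f(x - t)`; that is,
`τ_t e_r = e_r(-t) e_r` with `e_r(x) = e^{2 π i r x}`. -/
def translate (t : UnitAddTorus J) : FourierPoly P →⋆ₐ[ℂ] FourierPoly P :=
  let T : FourierPoly P →+ FourierPoly P := sumHom fun r =>
    AddMonoidHom.mk' (fun a => mono P r (UnitAddTorus.mFourier r (-t) * a)) fun a b => by
      rw [mul_add, mono_add]
  have hT : ∀ r a, T (mono P r a) = mono P r (UnitAddTorus.mFourier r (-t) * a) := fun r a => by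
    simp only [T, sumHom_mono, AddMonoidHom.mk'_apply]
  have hone : T 1 = 1 := by
    rw [one_def, hT, UnitAddTorus.mFourier_zero, ContinuousMap.one_apply, one_mul]
  { toFun := T
    map_one' := hone
    map_zero' := map_zero T
    map_add' := map_add T
    map_mul' := fun f g => by
      refine f.induction (by simp) (fun _ _ h₁ h₂ => ?_) fun r a => ?_
      · rw [add_mul, map_add, map_add, add_mul, h₁, h₂]
      refine g.induction (by simp) (fun _ _ h₁ h₂ => ?_) fun s b => ?_
      · rw [mul_add, map_add, map_add, mul_add, h₁, h₂]
      rw [mono_mul_mono, hT, hT, hT, mono_mul_mono, UnitAddTorus.mFourier_add]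
      ring_nf
    commutes' := fun c => by
      rw [Algebra.algebraMap_eq_smul_one, one_def, smul_mono, hT, UnitAddTorus.mFourier_zero,
        ContinuousMap.one_apply, one_mul]
    map_star' := fun f => by
      refine f.induction (by simp) (fun _ _ h₁ h₂ => ?_) fun r a => ?_
      · rw [star_add, map_add, map_add, star_add, h₁, h₂]
      · rw [star_mono, hT, hT, star_mono, UnitAddTorus.mFourier_neg, star_mul, mul_comm]
        rfl }

theorem translate_mono (t : UnitAddTorus J) (r : J → ℤ) (a : ℂ) :
    translate t (mono P r a) = mono P r (UnitAddTorus.mFourier r (-t) * a) := by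
  change sumHom _ (mono P r a) = _
  rw [sumHom_mono, AddMonoidHom.mk'_apply]

theorem mFourier_add_arg (r : J → ℤ) (s t : UnitAddTorus J) :
    UnitAddTorus.mFourier r (s + t) = UnitAddTorus.mFourier r s * UnitAddTorus.mFourier r t := by
  simp only [UnitAddTorus.mFourier, ContinuousMap.coe_mk, ← Finset.prod_mul_distrib]
  exact Finset.prod_congr rfl fun i _ => by
    simp [fourier_apply, smul_add, AddCircle.toCircle_add]

theorem translate_add (s t : UnitAddTorus J) (f : FourierPoly P) :
    translate (s + t) f = translate s (translate t f) := by
  refine f.induction (by simp) (fun _ _ h₁ h₂ => ?_) fun r a => ?_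
  · simp only [map_add, h₁, h₂]
  · rw [translate_mono, translate_mono, translate_mono, neg_add, mFourier_add_arg, mul_assoc]

theorem translate_zero (f : FourierPoly P) : translate (0 : UnitAddTorus J) f = f := by
  refine f.induction (by simp) (fun _ _ h₁ h₂ => ?_) fun r a => ?_
  · simp only [map_add, h₁, h₂]
  · rw [translate_mono]
    simp [UnitAddTorus.mFourier, fourier_apply]

end FourierPoly

/-- The quantum torus algebra `𝒜_Π`: the C⋆-completion of the twisted algebra of finite Fourier
series on the torus, i.e. the C⋆-algebra generated by unitaries `e_r` (`r ∈ ℤ^J`) subject to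
`e_r e_s = e^{-π i Π(r,s)} e_{r+s}`. -/
abbrev QuantumTorus (P : PoissonTensor J) : Type := UniversalCStar (FourierPoly P)

/-- The action of the torus `𝕋^J` on the quantum torus algebra by translations. -/
def translationAction (P : PoissonTensor J) :
    Multiplicative (UnitAddTorus J) →* (QuantumTorus P ≃⋆ₐ[ℂ] QuantumTorus P) where
  toFun t := universalEquiv (FourierPoly.translate t.toAdd) (FourierPoly.translate (-t.toAdd))
    (fun f => by rw [← FourierPoly.translate_add, neg_add_cancel, FourierPoly.translate_zero])
    (fun f => by rw [← FourierPoly.translate_add, add_neg_cancel, FourierPoly.translate_zero])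
  map_one' := by
    ext x
    rw [universalEquiv_apply, StarAlgEquiv.one_apply]
    refine dense_toUniversal.induction_on x ?_ ?_
    · exact isClosed_eq (continuous_universalMap _) continuous_id
    · intro f
      rw [universalMap_apply, toAdd_one, FourierPoly.translate_zero]
  map_mul' s t := by
    ext x
    rw [StarAlgEquiv.mul_apply, universalEquiv_apply, universalEquiv_apply, universalEquiv_apply]
    refine dense_toUniversal.induction_on x ?_ ?_
    · exact isClosed_eq (continuous_universalMap _)
        ((continuous_universalMap _).comp (continuous_universalMap _))
    · intro f
      rw [universalMap_apply, universalMap_apply, universalMap_apply, toAdd_mul,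
        FourierPoly.translate_add]

end QuantumTorus

/-! ## Crossed products by discrete groups -/

section CrossedProduct

set_option linter.unusedSectionVars false

variable {A G : Type} [CStarAlgebra A] [Group G]

/-- The space `C_c(G, A)` of finitely supported functions `∑ a_g u_g` from a discrete group `G` to
`A`; below it carries the convolution product determined by the action `α` of `G` on `A`. -/
@[nolint unusedArguments]
def CrossedPoly (_α : G →* (A ≃⋆ₐ[ℂ] A)) : Type := G →₀ A

namespace CrossedPoly

variable (α : G →* (A ≃⋆ₐ[ℂ] A))

instance : AddCommGroup (CrossedPoly α) := inferInstanceAs (AddCommGroup (G →₀ A))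
instance : Module ℂ (CrossedPoly α) := inferInstanceAs (Module ℂ (G →₀ A))

/-- The element `a u_g`. -/
def mono (g : G) (a : A) : CrossedPoly α := Finsupp.single g a

variable {α}

theorem mono_add (g : G) (a b : A) : mono α g (a + b) = mono α g a + mono α g b :=
  Finsupp.single_add g a b

theorem mono_zero (g : G) : mono α g 0 = 0 := Finsupp.single_zero g

theorem smul_mono (c : ℂ) (g : G) (a : A) : c • mono α g a = mono α g (c • a) :=
  Finsupp.smul_single c g a

@[elab_as_elim]
theorem induction {p : CrossedPoly α → Prop} (x : CrossedPoly α) (zero : p 0)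
    (add : ∀ x y, p x → p y → p (x + y)) (mono : ∀ g a, p (mono α g a)) : p x :=
  Finsupp.induction_linear x zero add mono

/-- The additive map with prescribed values on the elements `a u_g`. -/
def sumHom {N : Type*} [AddCommGroup N] (F : G → A →+ N) : CrossedPoly α →+ N :=
  Finsupp.liftAddHom F

theorem sumHom_mono {N : Type*} [AddCommGroup N] (F : G → A →+ N) (g : G) (a : A) :
    sumHom F (mono α g a) = F g a :=
  Finsupp.liftAddHom_apply_single F g a

/-- The convolution product as a biadditive map, `(a u_g) (b u_h) = a α_g(b) u_{gh}`. -/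
def mulHom : CrossedPoly α →+ CrossedPoly α →+ CrossedPoly α :=
  sumHom fun g => AddMonoidHom.mk' (fun a => sumHom fun h => AddMonoidHom.mk'
      (fun b => mono α (g * h) (a * α g b))
      fun b b' => by rw [← mono_add, map_add, mul_add])
    fun a a' => by
      refine AddMonoidHom.ext fun x => x.induction (by simp) (fun x y hx hy => ?_) fun h b => ?_
      · rw [map_add, map_add, hx, hy]
      · rw [AddMonoidHom.add_apply, sumHom_mono, sumHom_mono, sumHom_mono]
        simp only [AddMonoidHom.mk'_apply]
        rw [← mono_add, add_mul]

instance : Mul (CrossedPoly α) := ⟨fun x y => mulHom x y⟩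
instance : One (CrossedPoly α) := ⟨mono α 1 1⟩

theorem one_def : (1 : CrossedPoly α) = mono α 1 1 := rfl

theorem mono_mul_mono (g h : G) (a b : A) :
    mono α g a * mono α h b = mono α (g * h) (a * α g b) := by
  change mulHom (mono α g a) (mono α h b) = _
  rw [mulHom, sumHom_mono, AddMonoidHom.mk'_apply, sumHom_mono, AddMonoidHom.mk'_apply]

theorem mul_add' (x y z : CrossedPoly α) : x * (y + z) = x * y + x * z :=
  map_add (mulHom x) y z

theorem add_mul' (x y z : CrossedPoly α) : (x + y) * z = x * z + y * z := by
  change mulHom (x + y) z = mulHom x z + mulHom y z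
  rw [map_add, AddMonoidHom.add_apply]

theorem zero_mul' (x : CrossedPoly α) : 0 * x = 0 := by
  change mulHom 0 x = 0
  simp

theorem mul_zero' (x : CrossedPoly α) : x * 0 = 0 := map_zero (mulHom x)

instance : Ring (CrossedPoly α) :=
  { (inferInstance : AddCommGroup (CrossedPoly α)) with
    mul := (· * ·)
    one := 1
    left_distrib := mul_add'
    right_distrib := add_mul'
    zero_mul := zero_mul'
    mul_zero := mul_zero'
    mul_assoc := fun x y z => by
      refine x.induction (by simp only [zero_mul']) (fun _ _ h₁ h₂ => ?_) fun r a => ?_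
      · simp only [add_mul', h₁, h₂]
      refine y.induction (by simp only [zero_mul', mul_zero']) (fun _ _ h₁ h₂ => ?_) fun s b => ?_
      · simp only [add_mul', mul_add', h₁, h₂]
      refine z.induction (by simp only [mul_zero']) (fun _ _ h₁ h₂ => ?_) fun t c => ?_
      · simp only [mul_add', h₁, h₂]
      rw [mono_mul_mono, mono_mul_mono, mono_mul_mono, mono_mul_mono, mul_assoc, map_mul α,
        StarAlgEquiv.mul_apply, map_mul (α r), mul_assoc]
    one_mul := fun x => by
      refine x.induction (mul_zero' _) (fun _ _ h₁ h₂ => ?_) fun r a => ?_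
      · rw [mul_add', h₁, h₂]
      · rw [one_def, mono_mul_mono, map_one α, StarAlgEquiv.one_apply, one_mul, one_mul]
    mul_one := fun x => by
      refine x.induction (zero_mul' _) (fun _ _ h₁ h₂ => ?_) fun r a => ?_
      · rw [add_mul', h₁, h₂]
      · rw [one_def, mono_mul_mono, map_one (α r), mul_one, mul_one] }

instance : Algebra ℂ (CrossedPoly α) :=
  Algebra.ofModule
    (fun c x y => by
      refine x.induction (by simp) (fun _ _ h₁ h₂ => ?_) fun r a => ?_
      · rw [smul_add, add_mul, add_mul, h₁, h₂, smul_add]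
      refine y.induction (by simp) (fun _ _ h₁ h₂ => ?_) fun s b => ?_
      · rw [mul_add, mul_add, h₁, h₂, smul_add]
      rw [smul_mono, mono_mul_mono, mono_mul_mono, smul_mono, smul_mul_assoc])
    (fun c x y => by
      refine x.induction (by simp) (fun _ _ h₁ h₂ => ?_) fun r a => ?_
      · rw [add_mul, add_mul, h₁, h₂, smul_add]
      refine y.induction (by simp) (fun _ _ h₁ h₂ => ?_) fun s b => ?_
      · rw [smul_add, mul_add, mul_add, h₁, h₂, smul_add]
      rw [smul_mono, mono_mul_mono, mono_mul_mono, smul_mono, map_smul, mul_smul_comm])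

/-- The involution, `(a u_g)⋆ = α_{g⁻¹}(a⋆) u_{g⁻¹}`. -/
def starHom : CrossedPoly α →+ CrossedPoly α :=
  sumHom fun g => AddMonoidHom.mk' (fun a => mono α g⁻¹ (α g⁻¹ (star a))) fun a b => by
    rw [star_add, map_add, mono_add]

instance : Star (CrossedPoly α) := ⟨starHom⟩

theorem star_mono (g : G) (a : A) : star (mono α g a) = mono α g⁻¹ (α g⁻¹ (star a)) := by
  change starHom (mono α g a) = _
  rw [starHom, sumHom_mono, AddMonoidHom.mk'_apply]

theorem star_add' (x y : CrossedPoly α) : star (x + y) = star x + star y :=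
  map_add starHom x y

theorem star_zero' : star (0 : CrossedPoly α) = 0 := map_zero starHom

instance : StarRing (CrossedPoly α) where
  star_involutive x := by
    refine x.induction (by rw [star_zero', star_zero']) (fun _ _ h₁ h₂ => ?_) fun r a => ?_
    · rw [star_add', star_add', h₁, h₂]
    · rw [star_mono, star_mono, ← map_star, star_star, inv_inv, ← StarAlgEquiv.mul_apply,
        ← map_mul α, mul_inv_cancel, map_one α, StarAlgEquiv.one_apply]
  star_add := star_add'
  star_mul x y := by
    refine x.induction (by simp [star_zero']) (fun _ _ h₁ h₂ => ?_) fun r a => ?_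
    · rw [add_mul, star_add', star_add', mul_add, h₁, h₂]
    refine y.induction (by simp [star_zero']) (fun _ _ h₁ h₂ => ?_) fun s b => ?_
    · rw [mul_add, star_add', star_add', add_mul, h₁, h₂]
    rw [mono_mul_mono, star_mono, star_mono, star_mono, mono_mul_mono, star_mul, mul_inv_rev,
      map_mul (α (s⁻¹ * r⁻¹)), map_mul α, StarAlgEquiv.mul_apply, StarAlgEquiv.mul_apply,
      ← map_star (α r), ← StarAlgEquiv.mul_apply (α r⁻¹), ← map_mul α, inv_mul_cancel, map_one α,
      StarAlgEquiv.one_apply]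

instance : StarModule ℂ (CrossedPoly α) where
  star_smul c x := by
    refine x.induction (by simp) (fun _ _ h₁ h₂ => ?_) fun r a => ?_
    · rw [smul_add, star_add, star_add, smul_add, h₁, h₂]
    · rw [smul_mono, star_mono, star_mono, smul_mono, star_smul, map_smul]

/-- The inclusion of `A` into `C_c(G, A)` as the functions supported at the identity. -/
def inclusion : A →⋆ₙₐ[ℂ] CrossedPoly α where
  toFun a := mono α 1 a
  map_smul' c a := (smul_mono c 1 a).symm
  map_zero' := mono_zero 1
  map_add' := mono_add 1
  map_mul' a b := by rw [mono_mul_mono, map_one α, StarAlgEquiv.one_apply, one_mul]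
  map_star' a := by rw [star_mono, inv_one, map_one α, StarAlgEquiv.one_apply]

theorem star_mul_mono (g : G) : star (mono α g 1) * mono α g 1 = 1 := by
  rw [star_mono, mono_mul_mono, star_one, map_one (α g⁻¹), inv_mul_cancel, mul_one, one_def]

instance : HasUniversalCStar (CrossedPoly α) where
  bounded x := by
    refine x.induction ⟨0, fun p => (map_zero p.toSeminorm).le⟩ ?_ ?_
    · rintro f g ⟨K, hK⟩ ⟨L, hL⟩
      exact ⟨K + L, fun p => (map_add_le_add p.toSeminorm f g).trans (add_le_add (hK p) (hL p))⟩
    · intro g a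
      refine ⟨‖a‖, fun p => ?_⟩
      have h : mono α g a = inclusion a * mono α g 1 := by
        change _ = mono α 1 a * mono α g 1
        rw [mono_mul_mono, one_mul, map_one, mul_one]
      rw [h]
      refine (p.mul_le _ _).trans ((mul_le_of_le_one_right (apply_nonneg _ _)
        (p.le_one_of_isometry (star_mul_mono g))).trans (p.apply_le_norm inclusion a))

end CrossedPoly

/-- The (full) crossed product C⋆-algebra `A ⋊_α G` of a unital C⋆-algebra by an action of a
discrete group: the completion of the convolution ⋆-algebra `C_c(G, A)` with respect to its
greatest C⋆-seminorm, i.e. the universal C⋆-algebra of covariant representations. -/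
abbrev CrossedProduct (α : G →* (A ≃⋆ₐ[ℂ] A)) : Type := UniversalCStar (CrossedPoly α)

end CrossedProduct

/-! ## Linear Dirac structures -/

section Dirac

open Module

variable {V : Type} [AddCommGroup V] [Module ℝ V]

/-- The symmetric bilinear form `⟨X₁ + ξ₁, X₂ + ξ₂⟩ = (ξ₁(X₂) + ξ₂(X₁)) / 2` on `V ⊕ V*`. -/
def pairing (x y : V × Dual ℝ V) : ℝ := (1 / 2) * (x.2 y.1 + y.2 x.1)

/-- Isotropic subspaces of `V ⊕ V*`. -/
def IsIsotropic (L : Submodule ℝ (V × Dual ℝ V)) : Prop :=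
  ∀ x ∈ L, ∀ y ∈ L, pairing x y = 0

variable (V) in
/-- A Dirac structure on `V`: a maximal isotropic subspace of `V ⊕ V*`. -/
@[ext]
structure DiracStructure where
  carrier : Submodule ℝ (V × Dual ℝ V)
  maximal : Maximal IsIsotropic carrier

namespace DiracStructure

variable (Γ : DiracStructure V)

theorem isotropic {x y : V × Dual ℝ V} (hx : x ∈ Γ.carrier) (hy : y ∈ Γ.carrier) :
    x.2 y.1 + y.2 x.1 = 0 := by
  have := Γ.maximal.prop x hx y hy
  unfold pairing at this
  linarith

/-- The characteristic subspace `C(Γ) = Γ ∩ V`. -/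
def charSubspace : Submodule ℝ V := Γ.carrier.comap (LinearMap.inl ℝ V (Dual ℝ V))

theorem mem_charSubspace {X : V} : X ∈ Γ.charSubspace ↔ (X, (0 : Dual ℝ V)) ∈ Γ.carrier := Iff.rfl

theorem mem_charSubspace_of_forall {X : V} (h : ∀ x ∈ Γ.carrier, x.2 X = 0) :
    X ∈ Γ.charSubspace := by
  have hle : Γ.carrier ≤ Γ.carrier ⊔ Submodule.span ℝ {(X, (0 : Dual ℝ V))} := le_sup_left
  have hiso : IsIsotropic (Γ.carrier ⊔ Submodule.span ℝ {(X, (0 : Dual ℝ V))}) := by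
    intro x hx y hy
    obtain ⟨x', hx', u, hu, rfl⟩ := Submodule.mem_sup.1 hx
    obtain ⟨y', hy', v, hv, rfl⟩ := Submodule.mem_sup.1 hy
    obtain ⟨a, rfl⟩ := Submodule.mem_span_singleton.1 hu
    obtain ⟨b, rfl⟩ := Submodule.mem_span_singleton.1 hv
    have := Γ.isotropic hx' hy'
    simp only [pairing, Prod.snd_add, Prod.smul_snd, smul_zero, add_zero, Prod.fst_add,
      Prod.smul_fst, map_add, map_smul, h x' hx', h y' hy', this, mul_zero]
  exact Γ.maximal.2 hiso hle (Submodule.mem_sup_right (Submodule.mem_span_singleton_self _))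

/-- Every covector annihilating `C(Γ)` is the second component of an element of `Γ`. -/
theorem exists_mem_of_annihilates [FiniteDimensional ℝ V] {ξ : Dual ℝ V}
    (hξ : ∀ X ∈ Γ.charSubspace, ξ X = 0) : ∃ X : V, (X, ξ) ∈ Γ.carrier := by
  have h : ξ ∈ (Submodule.map (LinearMap.snd ℝ V (Dual ℝ V)) Γ.carrier).dualCoannihilator.dualAnnihilator := by
    rw [Submodule.mem_dualAnnihilator]
    intro X hX
    refine hξ X (Γ.mem_charSubspace_of_forall fun x hx => ?_)
    rw [Submodule.mem_dualCoannihilator] at hX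
    exact hX x.2 (Submodule.mem_map_of_mem (f := LinearMap.snd ℝ V (Dual ℝ V)) hx)
  rw [Subspace.dualCoannihilator_dualAnnihilator_eq] at h
  obtain ⟨x, hx, hxξ⟩ := h
  exact ⟨x.1, by rw [← hxξ]; exact hx⟩

theorem exists_mem_comp_mkQ [FiniteDimensional ℝ V] (ξ : Dual ℝ (V ⧸ Γ.charSubspace)) :
    ∃ X : V, (X, ξ ∘ₗ Γ.charSubspace.mkQ) ∈ Γ.carrier :=
  Γ.exists_mem_of_annihilates fun X hX => by
    rw [LinearMap.comp_apply, Submodule.mkQ_apply, (Submodule.Quotient.mk_eq_zero _).2 hX, map_zero]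

/-- The natural bivector `Π_Γ` on `V / C(Γ)`: its value at covectors `ξ, η` of `V / C(Γ)` is
`ξ(X)` for any `X` with `(X, η) ∈ Γ`. -/
def bivector [FiniteDimensional ℝ V] (ξ η : Dual ℝ (V ⧸ Γ.charSubspace)) : ℝ :=
  ξ (Γ.charSubspace.mkQ (Γ.exists_mem_comp_mkQ η).choose)

theorem bivector_eq [FiniteDimensional ℝ V] (ξ η : Dual ℝ (V ⧸ Γ.charSubspace)) {X : V}
    (hX : (X, η ∘ₗ Γ.charSubspace.mkQ) ∈ Γ.carrier) :
    Γ.bivector ξ η = ξ (Γ.charSubspace.mkQ X) := by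
  rw [bivector]
  congr 1
  rw [← sub_eq_zero, ← map_sub, Submodule.mkQ_apply, Submodule.Quotient.mk_eq_zero,
    mem_charSubspace]
  have := Γ.carrier.sub_mem (Γ.exists_mem_comp_mkQ η).choose_spec hX
  rwa [Prod.mk_sub_mk, sub_self] at this

theorem bivector_swap [FiniteDimensional ℝ V] (ξ η : Dual ℝ (V ⧸ Γ.charSubspace)) :
    Γ.bivector η ξ = -Γ.bivector ξ η := by
  have := Γ.isotropic (Γ.exists_mem_comp_mkQ ξ).choose_spec (Γ.exists_mem_comp_mkQ η).choose_spec
  simp only [LinearMap.comp_apply] at this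
  rw [bivector, bivector]
  linarith

/-- The image of a Dirac structure under a linear automorphism of `V ⊕ V*` preserving the
bilinear form. -/
def map (e : (V × Dual ℝ V) ≃ₗ[ℝ] (V × Dual ℝ V))
    (he : ∀ x y, pairing (e x) (e y) = pairing x y) : DiracStructure V where
  carrier := Γ.carrier.map (e : (V × Dual ℝ V) →ₗ[ℝ] (V × Dual ℝ V))
  maximal := by
    constructor
    · rintro _ ⟨x, hx, rfl⟩ _ ⟨y, hy, rfl⟩
      exact (he x y).trans (Γ.maximal.prop x hx y hy)
    · intro L hL hle x hx
      have h1 : IsIsotropic (L.comap (e : (V × Dual ℝ V) →ₗ[ℝ] (V × Dual ℝ V))) :=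
        fun x hx y hy => (he x y).symm.trans (hL _ hx _ hy)
      have h2 := Γ.maximal.2 h1 (Submodule.map_le_iff_le_comap.1 hle)
      refine ⟨e.symm x, h2 ?_, e.apply_symm_apply x⟩
      change e (e.symm x) ∈ L
      rwa [e.apply_symm_apply]

end DiracStructure

end Dirac

section Coordinates

open Module

variable {n : ℕ}

/-- The coordinate subspace `ℝ^S` of `ℝ^n` spanned by the `e_i` with `i ∈ S`. -/
def coordSubspace (S : Finset (Fin n)) : Submodule ℝ (Fin n → ℝ) :=
  Submodule.span ℝ {v | ∃ i ∈ S, v = Pi.single i 1}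

theorem apply_eq_zero_of_mem_coordSubspace {S : Finset (Fin n)} {X : Fin n → ℝ}
    (hX : X ∈ coordSubspace S) {i : Fin n} (hi : i ∉ S) : X i = 0 := by
  refine Submodule.span_induction ?_ rfl ?_ ?_ hX
  · rintro _ ⟨j, hj, rfl⟩
    exact Pi.single_eq_of_ne (M := fun _ => ℝ) (fun h => hi (by rwa [h])) 1
  · intro x y _ _ hx hy
    rw [Pi.add_apply, hx, hy, add_zero]
  · intro c x _ hx
    rw [Pi.smul_apply, hx, smul_zero]

theorem mem_coordSubspace {S : Finset (Fin n)} {X : Fin n → ℝ} :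
    X ∈ coordSubspace S ↔ ∀ i ∉ S, X i = 0 := by
  refine ⟨fun hX i hi => apply_eq_zero_of_mem_coordSubspace hX hi, fun hX => ?_⟩
  rw [pi_eq_sum_univ' X]
  refine Submodule.sum_mem _ fun i _ => ?_
  by_cases hi : i ∈ S
  · exact Submodule.smul_mem _ _ (Submodule.subset_span ⟨i, hi, rfl⟩)
  · rw [hX i hi, zero_smul]
    exact Submodule.zero_mem _

/-- The map `σ_I` on `ℝ^n ⊕ (ℝ^n)*` exchanging `e_i` with the dual basis vector `f_i` for `i ∈ I`
and fixing the other `e_i` and `f_i`; a covector `ξ` has the coordinates `ξ(e_i)`. -/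
def sigmaLin (I : Finset (Fin n)) :
    ((Fin n → ℝ) × Dual ℝ (Fin n → ℝ)) →ₗ[ℝ] ((Fin n → ℝ) × Dual ℝ (Fin n → ℝ)) where
  toFun x := (fun i => if i ∈ I then x.2 (Pi.single i 1) else x.1 i,
    ∑ i, (if i ∈ I then x.1 i else x.2 (Pi.single i 1)) • LinearMap.proj i)
  map_add' x y := by
    refine Prod.ext (funext fun i => ?_) ?_
    · simp only [Prod.fst_add, Prod.snd_add, LinearMap.add_apply, Pi.add_apply]
      split_ifs <;> rfl
    · simp only [Prod.fst_add, Prod.snd_add, LinearMap.add_apply, Pi.add_apply,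
        ← Finset.sum_add_distrib, ← add_smul]
      refine Finset.sum_congr rfl fun i _ => ?_
      split_ifs <;> rfl
  map_smul' c x := by
    refine Prod.ext (funext fun i => ?_) ?_
    · simp only [Prod.smul_fst, Prod.smul_snd, LinearMap.smul_apply, Pi.smul_apply,
        RingHom.id_apply]
      split_ifs <;> rfl
    · simp only [Prod.smul_fst, Prod.smul_snd, LinearMap.smul_apply, Pi.smul_apply,
        RingHom.id_apply, Finset.smul_sum, smul_smul]
      refine Finset.sum_congr rfl fun i _ => ?_
      split_ifs <;> rfl

theorem sigmaLin_fst (I : Finset (Fin n)) (x : (Fin n → ℝ) × Dual ℝ (Fin n → ℝ)) (i : Fin n) :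
    (sigmaLin I x).1 i = if i ∈ I then x.2 (Pi.single i 1) else x.1 i := rfl

theorem sigmaLin_snd (I : Finset (Fin n)) (x : (Fin n → ℝ) × Dual ℝ (Fin n → ℝ)) (i : Fin n) :
    (sigmaLin I x).2 (Pi.single i 1) = if i ∈ I then x.1 i else x.2 (Pi.single i 1) := by
  change (∑ j, (if j ∈ I then x.1 j else x.2 (Pi.single j 1)) •
    (LinearMap.proj j : (Fin n → ℝ) →ₗ[ℝ] ℝ)) (Pi.single i 1) = _
  rw [LinearMap.sum_apply, Finset.sum_eq_single i]
  · rw [LinearMap.smul_apply, LinearMap.proj_apply, Pi.single_eq_same, smul_eq_mul, mul_one]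
  · intro j _ hj
    rw [LinearMap.smul_apply, LinearMap.proj_apply, Pi.single_eq_of_ne hj, smul_zero]
  · exact fun hi => absurd (Finset.mem_univ i) hi

theorem dual_apply_eq_sum (ξ : Dual ℝ (Fin n → ℝ)) (X : Fin n → ℝ) :
    ξ X = ∑ i, X i * ξ (Pi.single i 1) := by
  conv_lhs => rw [pi_eq_sum_univ' X, map_sum]
  refine Finset.sum_congr rfl fun i _ => ?_
  rw [map_smul, smul_eq_mul]

theorem sigmaLin_involutive (I : Finset (Fin n)) : Function.Involutive (sigmaLin I) := by
  intro x
  refine Prod.ext (funext fun i => ?_) (LinearMap.pi_ext' fun i => LinearMap.ext_ring ?_)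
  · rw [sigmaLin_fst, sigmaLin_fst, sigmaLin_snd]
    split_ifs <;> rfl
  · change (sigmaLin I (sigmaLin I x)).2 (Pi.single i 1) = x.2 (Pi.single i 1)
    rw [sigmaLin_snd, sigmaLin_snd, sigmaLin_fst]
    split_ifs <;> rfl

theorem pairing_sigmaLin (I : Finset (Fin n)) (x y : (Fin n → ℝ) × Dual ℝ (Fin n → ℝ)) :
    pairing (sigmaLin I x) (sigmaLin I y) = pairing x y := by
  unfold pairing
  rw [dual_apply_eq_sum (sigmaLin I x).2, dual_apply_eq_sum (sigmaLin I y).2,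
    dual_apply_eq_sum x.2, dual_apply_eq_sum y.2, ← Finset.sum_add_distrib,
    ← Finset.sum_add_distrib]
  congr 1
  refine Finset.sum_congr rfl fun i _ => ?_
  simp only [sigmaLin_snd, sigmaLin_fst]
  split_ifs <;> ring

/-- The Dirac structure `σ_I(Γ)`. -/
def sigma (I : Finset (Fin n)) (Γ : DiracStructure (Fin n → ℝ)) : DiracStructure (Fin n → ℝ) :=
  Γ.map (LinearEquiv.ofInvolutive (sigmaLin I) (sigmaLin_involutive I)) (pairing_sigmaLin I)

/-- The linear map `(ℝ^n)* → ℝ^n` of which the skew-symmetric matrix `Π` is the matrix. -/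
def PoissonTensor.toLin (P : PoissonTensor (Fin n)) : Dual ℝ (Fin n → ℝ) →ₗ[ℝ] (Fin n → ℝ) where
  toFun ξ := P.matrix.mulVec fun j => ξ (Pi.single j 1)
  map_add' ξ η := P.matrix.mulVec_add (fun j => ξ (Pi.single j 1)) fun j => η (Pi.single j 1)
  map_smul' c ξ := P.matrix.mulVec_smul c fun j => ξ (Pi.single j 1)

/-- The graph `Γ_Π = {(Π ξ, ξ) | ξ ∈ (ℝ^n)*}` of a Poisson structure. -/
def PoissonTensor.graph (P : PoissonTensor (Fin n)) :
    Submodule ℝ ((Fin n → ℝ) × Dual ℝ (Fin n → ℝ)) :=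
  LinearMap.range (P.toLin.prod LinearMap.id)

/-- `Γ` is the Dirac structure `Γ_Π` of the Poisson structure `Π`. -/
def IsPoisson (Γ : DiracStructure (Fin n → ℝ)) (P : PoissonTensor (Fin n)) : Prop :=
  Γ.carrier = P.graph

end Coordinates

/-! ## Quantization of a Dirac structure by means of a coordinate transversal -/

section Quantization

open Module

variable {n : ℕ} (Γ : DiracStructure (Fin n → ℝ)) (I : Finset (Fin n))
  (h : IsCompl (coordSubspace Iᶜ) Γ.charSubspace)

/-- The coordinate covector `f_i`, `i ∉ I`, of the transversal `ℝ^{I'}`, regarded as a covector of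
`ℝ^n / C(Γ)` by means of the isomorphism `ℝ^n / C(Γ) ≅ ℝ^{I'}`. -/
def transverseCovector (i : {i : Fin n // i ∉ I}) : Dual ℝ ((Fin n → ℝ) ⧸ Γ.charSubspace) :=
  LinearMap.proj (R := ℝ) (φ := fun _ : Fin n => ℝ) i.1 ∘ₗ (coordSubspace Iᶜ).subtype ∘ₗ
    (Submodule.quotientEquivOfIsCompl _ _ h.symm).toLinearMap

/-- The Poisson structure `Π_{Γ,M}` induced on the coordinate subtorus `M = 𝕋^{I'}`, obtained from
the natural bivector on `ℝ^n / C(Γ)` by means of the isomorphism `ℝ^n / C(Γ) ≅ ℝ^{I'}`. -/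
def transversePoisson : PoissonTensor {i : Fin n // i ∉ I} where
  matrix := Matrix.of fun i j =>
    Γ.bivector (transverseCovector Γ I h i) (transverseCovector Γ I h j)
  skew := by
    ext i j
    exact Γ.bivector_swap (transverseCovector Γ I h i) (transverseCovector Γ I h j)

/-- Extension by zero `ℝ^I → ℝ^n`. -/
def extendZero : ({i : Fin n // i ∈ I} → ℝ) →ₗ[ℝ] (Fin n → ℝ) where
  toFun y i := if hi : i ∈ I then y ⟨i, hi⟩ else 0
  map_add' x y := by
    ext i
    simp only [Pi.add_apply]
    split_ifs <;> simp
  map_smul' c y := by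
    ext i
    simp only [Pi.smul_apply, RingHom.id_apply]
    split_ifs <;> simp

/-- The linear map `β : ℝ^I → ℝ^{I'}` whose graph is `C(Γ)`: minus the projection onto `ℝ^{I'}`
along `C(Γ)`. -/
def beta : ({i : Fin n // i ∈ I} → ℝ) →ₗ[ℝ] ({i : Fin n // i ∉ I} → ℝ) where
  toFun y i := -((coordSubspace Iᶜ).projectionOnto Γ.charSubspace h (extendZero I y) : Fin n → ℝ) i
  map_add' x y := by
    ext i
    simp only [map_add, Submodule.coe_add, Pi.add_apply, neg_add]
  map_smul' c y := by
    ext i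
    simp only [map_smul, Submodule.coe_smul, Pi.smul_apply, RingHom.id_apply, smul_neg]

/-- `C(Γ)` is the graph of `β`. -/
theorem mem_charSubspace_iff_beta (X : Fin n → ℝ) :
    X ∈ Γ.charSubspace ↔ (fun i : {i : Fin n // i ∉ I} => X i) =
      beta Γ I h (fun i : {i : Fin n // i ∈ I} => X i) := by
  set y : {i : Fin n // i ∈ I} → ℝ := fun i => X i
  have hmem : X - extendZero I y ∈ coordSubspace Iᶜ := by
    rw [mem_coordSubspace]
    intro i hi
    have hi' : i ∈ I := by simpa using hi
    simp [extendZero, y, hi']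
  have hproj : ((coordSubspace Iᶜ).projectionOnto Γ.charSubspace h X : Fin n → ℝ) =
      (X - extendZero I y) +
        ((coordSubspace Iᶜ).projectionOnto Γ.charSubspace h (extendZero I y) : Fin n → ℝ) := by
    have h1 := Submodule.projectionOnto_apply_left h ⟨_, hmem⟩
    rw [map_sub, sub_eq_iff_eq_add] at h1
    rw [h1, Submodule.coe_add]
  rw [← Submodule.projectionOnto_apply_eq_zero_iff h, ← Submodule.coe_eq_zero]
  constructor
  · intro h0
    ext i
    have h2 := congrFun (hproj.symm.trans h0) i.1
    have h3 : extendZero I y i.1 = 0 := dif_neg i.2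
    simp only [Pi.add_apply, Pi.sub_apply, Pi.zero_apply, h3] at h2
    change X i.1 = -((coordSubspace Iᶜ).projectionOnto Γ.charSubspace h (extendZero I y) :
      Fin n → ℝ) i.1
    linarith
  · intro h0
    ext i
    by_cases hi : i ∈ I
    · exact apply_eq_zero_of_mem_coordSubspace (Subtype.prop _) (by simpa using hi)
    · have h2 : X i = -((coordSubspace Iᶜ).projectionOnto Γ.charSubspace h (extendZero I y) :
        Fin n → ℝ) i := congrFun h0 ⟨i, hi⟩
      have h3 : extendZero I y i = 0 := dif_neg hi
      rw [hproj, Pi.add_apply, Pi.sub_apply, h3, h2, Pi.zero_apply]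
      ring

/-- The holonomy `ℤ^I → M = 𝕋^{I'}` of the characteristic foliation, `m ↦ β(m) mod ℤ^{I'}`. -/
def holonomy : ({i : Fin n // i ∈ I} → ℤ) →+ UnitAddTorus {i : Fin n // i ∉ I} where
  toFun m i := ((beta Γ I h (fun j => (m j : ℝ)) i : ℝ) : UnitAddCircle)
  map_zero' := by
    have : (fun j : {i : Fin n // i ∈ I} => (((0 : {i : Fin n // i ∈ I} → ℤ) j : ℤ) : ℝ)) = 0 := by
      ext j
      simp
    ext i
    rw [this, map_zero]
    rfl
  map_add' m m' := by
    have : (fun j : {i : Fin n // i ∈ I} => (((m + m') j : ℤ) : ℝ)) =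
        (fun j => (m j : ℝ)) + fun j => (m' j : ℝ) := by
      ext j
      simp
    ext i
    rw [this, map_add]
    rfl

/-- The action of the lattice `ℤ^I` on the quantum torus algebra `𝒜_{Π_{Γ,M}}` induced by the
translation action of `ℤ^I` on the torus `M = 𝕋^{I'}` by holonomy. -/
def holonomyAction : Multiplicative ({i : Fin n // i ∈ I} → ℤ) →*
    (QuantumTorus (transversePoisson Γ I h) ≃⋆ₐ[ℂ] QuantumTorus (transversePoisson Γ I h)) :=
  (translationAction (transversePoisson Γ I h)).comp (AddMonoidHom.toMultiplicative (holonomy Γ I h))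

/-- The algebra `𝒜_{Γ,M} = 𝒜_{Π_{Γ,M}} ⋊ ℤ^I` for the transversal torus `M = 𝕋^{I'}`. -/
abbrev DiracAlgebra : Type := CrossedProduct (holonomyAction Γ I h)

end Quantization

end DiracQuant

end

/-! Notation: for r in ℤ^n, r' and r'' are the components in ℤ^{I'} and ℤ^I; `P` is the matrix Π.

Linear algebra. If (Y, 0) lies in σ_I(Γ), then σ_I(Y, 0) lies in Γ. Its covector part has
coordinates only in I, so it kills ℝ^{I'}; by isotropy it kills C(Γ). Complementarity makes it zero,
so the vector part lies in C(Γ) ∩ ℝ^{I'} = 0. Thus C(σ_I(Γ)) = 0 (`charSubspace_sigma`). A Dirac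
structure with zero characteristic subspace is a graph: maximality gives every covector a partner
vector, triviality of C makes it unique, and isotropy is skewness.

Applying σ_I to well-chosen elements of Γ reads off the blocks of Π. The elements (y + β(y), 0) show
that the I×I block is zero and that the I'×I block is β (`mulVec_extendZero`). Elements (X, η) with
X in ℝ^{I'} and η a coordinate covector show that the I'×I' block is Π_{Γ,M}
(`matrix_apply_of_notMem`). Skewness fixes the remaining block, so (`form_eq`) Π(r, s) = Π_{Γ,M}(r',
s') + Π(r', s'') - Π(s', r'').

Operator algebra. In 𝒜_Π the e_{r'} generate a copy of the relations of 𝒜_{Π_{Γ,M}}, the e_{r''}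
commute with one another, and conjugating e_{r'} by e_{-m}, with m in ℤ^I, multiplies it by e^{-2πi
r'·β(m)}, which is exactly translation by β(m). So the inclusion of the e_{r'} and u_m ↦ e_{-m} form
a covariant pair (`latticeUnitary_covariant`), and the universal property of the crossed product
gives a map to 𝒜_Π. Conversely, the elements e^{πi Π(r', r'')} e_{r'} u_{-r''} satisfy the relations
of the e_r (`splitMono_mul`, `star_splitMono`), giving a map back. The two maps are inverse on
monomials, hence everywhere by density and continuity. -/

noncomputable section

namespace DiracQuant

/-! ## Universal properties -/

section Lift

open UniformSpace

universe u v

/-- The norm of a C⋆-algebra as a C⋆-seminorm. -/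
def CStarSeminorm.ofNorm (A : Type*) [CStarAlgebra A] : CStarSeminorm A :=
  { normSeminorm ℂ A with
    mul_le' := norm_mul_le
    star_mul_self' := fun x => by
      change ‖star x * x‖ = ‖x‖ ^ 2
      rw [CStarRing.norm_star_mul_self, sq] }

variable {B : Type u} [Ring B] [StarRing B] [Algebra ℂ B] [StarModule ℂ B] [HasUniversalCStar B]
variable {A : Type v} [CStarAlgebra A]

/-- The norm of `A` pulled back along `φ` is a C⋆-seminorm on `B`, hence at most the greatest one;
so `φ` is contractive. -/
theorem continuous_on_universalPre (φ : B →⋆ₐ[ℂ] A) :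
    Continuous (fun x : (universalSeminorm B).Pre => φ x) := by
  let f : (universalSeminorm B).Pre →+ A :=
    AddMonoidHom.mk' (fun x => φ x) fun x y => map_add φ (x : B) (y : B)
  refine AddMonoidHomClass.continuous_of_bound f 1 fun x => ?_
  rw [one_mul]
  exact le_universalSeminorm B ((CStarSeminorm.ofNorm A).comap φ) x

/-- The underlying ring homomorphism of `universalLift`. -/
def universalLiftRing (φ : B →⋆ₐ[ℂ] A) : UniversalCStar B →+* A :=
  Completion.extensionHom (α := (universalSeminorm B).Pre)
    ((φ : B →+* A) : (universalSeminorm B).Pre →+* A) (continuous_on_universalPre φ)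

theorem universalLiftRing_apply (φ : B →⋆ₐ[ℂ] A) (x : B) :
    universalLiftRing φ (toUniversal x) = φ x :=
  Completion.extensionHom_coe (α := (universalSeminorm B).Pre) _ (continuous_on_universalPre φ) x

theorem continuous_universalLiftRing (φ : B →⋆ₐ[ℂ] A) : Continuous (universalLiftRing φ) :=
  Completion.continuous_extension (α := (universalSeminorm B).Pre)

/-- The universal property of the universal C⋆-algebra: a ⋆-homomorphism from `B` to a C⋆-algebra
extends to the universal C⋆-algebra of `B`. -/
def universalLift (φ : B →⋆ₐ[ℂ] A) : UniversalCStar B →⋆ₐ[ℂ] A :=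
  { universalLiftRing φ with
    commutes' := fun c => by
      change universalLiftRing φ (algebraMap ℂ _ c) = _
      rw [← AlgHomClass.commutes (toUniversal : B →⋆ₐ[ℂ] UniversalCStar B) c,
        universalLiftRing_apply, AlgHomClass.commutes]
    map_star' := fun x => by
      change universalLiftRing φ (star x) = star (universalLiftRing φ x)
      refine dense_toUniversal.induction_on x ?_ ?_
      · exact isClosed_eq ((continuous_universalLiftRing φ).comp continuous_star)
          (continuous_star.comp (continuous_universalLiftRing φ))
      · intro a
        rw [← map_star, universalLiftRing_apply, universalLiftRing_apply, map_star] }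

theorem universalLift_apply (φ : B →⋆ₐ[ℂ] A) (x : B) :
    universalLift φ (toUniversal x) = φ x := universalLiftRing_apply φ x

theorem continuous_universalLift (φ : B →⋆ₐ[ℂ] A) : Continuous (universalLift φ) :=
  continuous_universalLiftRing φ

end Lift

/-! ### Universal property of the twisted Fourier algebra -/

section FourierLift

variable {J : Type} [Fintype J] {P : PoissonTensor J}
variable {B : Type*} [Ring B] [StarRing B] [Algebra ℂ B] [StarModule ℂ B]

/-- The ⋆-homomorphism out of the algebra of finite Fourier series determined by elements
satisfying the relations of the basis `e_r`. -/
def FourierPoly.lift (U : (J → ℤ) → B) (hone : U 0 = 1)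
    (hmul : ∀ r s, U r * U s = P.twist r s • U (r + s)) (hstar : ∀ r, star (U r) = U (-r)) :
    FourierPoly P →⋆ₐ[ℂ] B :=
  let T : FourierPoly P →+ B := sumHom fun r =>
    AddMonoidHom.mk' (fun a => a • U r) fun a b => add_smul a b (U r)
  have hT : ∀ r a, T (mono P r a) = a • U r := fun r a => by
    simp only [T, sumHom_mono, AddMonoidHom.mk'_apply]
  { toFun := T
    map_one' := by rw [one_def, hT, hone, one_smul]
    map_zero' := map_zero T
    map_add' := map_add T
    map_mul' := fun f g => by
      refine f.induction (by simp) (fun _ _ h₁ h₂ => ?_) fun r a => ?_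
      · rw [add_mul, map_add, map_add, add_mul, h₁, h₂]
      refine g.induction (by simp) (fun _ _ h₁ h₂ => ?_) fun s b => ?_
      · rw [mul_add, map_add, map_add, mul_add, h₁, h₂]
      rw [mono_mul_mono, hT, hT, hT, smul_mul_smul_comm, hmul, smul_smul]
    commutes' := fun c => by
      rw [Algebra.algebraMap_eq_smul_one, one_def, smul_mono, hT, hone, mul_one,
        Algebra.algebraMap_eq_smul_one]
    map_star' := fun f => by
      refine f.induction (by simp) (fun _ _ h₁ h₂ => ?_) fun r a => ?_
      · rw [star_add, map_add, map_add, star_add, h₁, h₂]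
      · rw [star_mono, hT, hT, star_smul, hstar] }

theorem FourierPoly.lift_mono (U : (J → ℤ) → B) (hone : U 0 = 1)
    (hmul : ∀ r s, U r * U s = P.twist r s • U (r + s)) (hstar : ∀ r, star (U r) = U (-r))
    (r : J → ℤ) (a : ℂ) : FourierPoly.lift U hone hmul hstar (mono P r a) = a • U r := by
  change sumHom _ (mono P r a) = _
  rw [sumHom_mono, AddMonoidHom.mk'_apply]

end FourierLift

/-! ### Covariant pairs and the crossed product -/

section CrossedLift

variable {A G : Type} [CStarAlgebra A] [Group G] {α : G →* (A ≃⋆ₐ[ℂ] A)}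
variable {B : Type*} [Ring B] [StarRing B] [Algebra ℂ B]

/-- The integrated form of a covariant pair. -/
def CrossedPoly.lift (π : A →⋆ₐ[ℂ] B) (V : G →* B) (hstar : ∀ g, star (V g) = V g⁻¹)
    (hcov : ∀ g a, V g * π a = π (α g a) * V g) : CrossedPoly α →⋆ₐ[ℂ] B :=
  let T : CrossedPoly α →+ B := sumHom fun g =>
    AddMonoidHom.mk' (fun a => π a * V g) fun a b => by rw [map_add, add_mul]
  have hT : ∀ g a, T (mono α g a) = π a * V g := fun g a => by
    simp only [T, sumHom_mono, AddMonoidHom.mk'_apply]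
  { toFun := T
    map_one' := by rw [one_def, hT, map_one, map_one, one_mul]
    map_zero' := map_zero T
    map_add' := map_add T
    map_mul' := fun x y => by
      refine x.induction (by simp) (fun _ _ h₁ h₂ => ?_) fun g a => ?_
      · rw [add_mul, map_add, map_add, add_mul, h₁, h₂]
      refine y.induction (by simp) (fun _ _ h₁ h₂ => ?_) fun k b => ?_
      · rw [mul_add, map_add, map_add, mul_add, h₁, h₂]
      rw [mono_mul_mono, hT, hT, hT, map_mul π, map_mul V, mul_assoc, mul_assoc,
        ← mul_assoc (V g), hcov, mul_assoc]
    commutes' := fun c => by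
      rw [Algebra.algebraMap_eq_smul_one, one_def, smul_mono, hT, map_smul, map_one, map_one,
        mul_one, Algebra.algebraMap_eq_smul_one]
    map_star' := fun x => by
      refine x.induction (by simp) (fun _ _ h₁ h₂ => ?_) fun g a => ?_
      · rw [star_add, map_add, map_add, star_add, h₁, h₂]
      -- Covariance at `g⁻¹` moves `V g⁻¹` to the right of `π (star a)`, which produces the factor
      -- `α g⁻¹` in the involution of the convolution algebra.
      · rw [star_mono, hT, hT, star_mul, hstar, ← map_star π, hcov] }

theorem CrossedPoly.lift_mono (π : A →⋆ₐ[ℂ] B) (V : G →* B) (hstar : ∀ g, star (V g) = V g⁻¹)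
    (hcov : ∀ g a, V g * π a = π (α g a) * V g) (g : G) (a : A) :
    CrossedPoly.lift π V hstar hcov (mono α g a) = π a * V g := by
  change sumHom _ (mono α g a) = _
  rw [sumHom_mono, AddMonoidHom.mk'_apply]

/-- Since a u_g = (a u_1)(1 u_g) and a ↦ a u_1 is a ⋆-homomorphism between C⋆-algebras, hence
contractive, the map is continuous. This allows identities on a u_g to be checked for a in a dense
subset of `A`. -/
theorem CrossedPoly.continuous_toUniversal_mono (g : G) :
    Continuous fun a : A => toUniversal (mono α g a) := by
  have h : (fun a : A => toUniversal (mono α g a)) = fun a =>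
      (((toUniversal : CrossedPoly α →⋆ₐ[ℂ] CrossedProduct α) :
        CrossedPoly α →⋆ₙₐ[ℂ] CrossedProduct α).comp inclusion) a *
        toUniversal (mono α g 1) := by
    funext a
    change _ = toUniversal (mono α 1 a) * _
    rw [← map_mul, mono_mul_mono, one_mul, map_one, mul_one]
  rw [h]
  refine Continuous.mul (AddMonoidHomClass.continuous_of_bound _ 1 fun a => ?_) continuous_const
  rw [one_mul]
  exact NonUnitalStarAlgHom.norm_apply_le _ a

end CrossedLift

/-! ## The Poisson structure `σ_I(Γ)` -/

section Linear

open Module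

variable {n : ℕ}

/-- The covector with given coordinates. -/
def covector (s : Fin n → ℝ) : Dual ℝ (Fin n → ℝ) := ∑ i, s i • LinearMap.proj i

theorem covector_apply (s X : Fin n → ℝ) : covector s X = s ⬝ᵥ X := by
  simp [covector, dotProduct]

theorem covector_single (s : Fin n → ℝ) (i : Fin n) : covector s (Pi.single i 1) = s i := by
  simp [covector_apply]

theorem dual_ext {ξ η : Dual ℝ (Fin n → ℝ)} (h : ∀ i, ξ (Pi.single i 1) = η (Pi.single i 1)) :
    ξ = η :=
  LinearMap.pi_ext' fun i => LinearMap.ext_ring (h i)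

theorem PoissonTensor.mem_graph {P : PoissonTensor (Fin n)}
    {x : (Fin n → ℝ) × Dual ℝ (Fin n → ℝ)} : x ∈ P.graph ↔ P.toLin x.2 = x.1 := by
  constructor
  · rintro ⟨ξ, rfl⟩
    rfl
  · intro h
    exact ⟨x.2, Prod.ext h rfl⟩

theorem PoissonTensor.toLin_eq {P : PoissonTensor (Fin n)} (ξ : Dual ℝ (Fin n → ℝ)) :
    P.toLin ξ = P.matrix.mulVec fun j => ξ (Pi.single j 1) := rfl

theorem PoissonTensor.toLin_covector {P : PoissonTensor (Fin n)} (s : Fin n → ℝ) :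
    P.toLin (covector s) = P.matrix.mulVec s := by
  rw [toLin_eq]
  simp only [covector_single]

theorem PoissonTensor.matrix_eq_toLin (P : PoissonTensor (Fin n)) (i j : Fin n) :
    P.matrix i j = P.toLin (covector (Pi.single j 1)) i := by
  rw [toLin_covector]
  simp

/-- The graph determines the image of each coordinate covector, that is, each column of the matrix.
-/
theorem PoissonTensor.eq_of_graph_eq {P Q : PoissonTensor (Fin n)} (h : P.graph = Q.graph) :
    P = Q := by
  ext i j
  have h1 : (P.toLin (covector (Pi.single j 1)), covector (Pi.single j 1)) ∈ Q.graph :=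
    h ▸ PoissonTensor.mem_graph.2 rfl
  rw [P.matrix_eq_toLin, Q.matrix_eq_toLin, PoissonTensor.mem_graph.1 h1]

/-- A Dirac structure with trivial characteristic subspace is a Poisson structure. -/
theorem exists_isPoisson_of_charSubspace_eq_bot (Γ : DiracStructure (Fin n → ℝ))
    (h : Γ.charSubspace = ⊥) : ∃ P : PoissonTensor (Fin n), IsPoisson Γ P := by
  have hex : ∀ ξ : Dual ℝ (Fin n → ℝ), ∃ X, (X, ξ) ∈ Γ.carrier := fun ξ =>
    Γ.exists_mem_of_annihilates fun X hX => by
      rw [h, Submodule.mem_bot] at hX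
      rw [hX, map_zero]
  have huniq : ∀ {X Y : Fin n → ℝ} {ξ : Dual ℝ (Fin n → ℝ)}, (X, ξ) ∈ Γ.carrier →
      (Y, ξ) ∈ Γ.carrier → X = Y := by
    intro X Y ξ hX hY
    have h1 := Γ.carrier.sub_mem hX hY
    rw [Prod.mk_sub_mk, sub_self, ← Γ.mem_charSubspace, h, Submodule.mem_bot] at h1
    exact sub_eq_zero.1 h1
  -- The partner of the j-th coordinate covector is the j-th column of the matrix; isotropy of pairs
  -- of these elements is skewness.
  choose X hX using fun j : Fin n => hex (covector (Pi.single j 1))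
  let P : PoissonTensor (Fin n) :=
    { matrix := Matrix.of fun i j => X j i
      skew := by
        ext i j
        have := Γ.isotropic (hX i) (hX j)
        simp only [covector_apply, single_dotProduct, one_mul] at this
        simp only [Matrix.transpose_apply, Matrix.of_apply, Matrix.neg_apply]
        linarith }
  have hP : ∀ ξ, (P.toLin ξ, ξ) ∈ Γ.carrier := by
    intro ξ
    -- Linearity in ξ reduces membership of the whole graph to the chosen columns.
    have h1 : (P.toLin ξ, ξ) = ∑ j, ξ (Pi.single j 1) • (X j, covector (Pi.single j 1)) := by
      refine Prod.ext ?_ (dual_ext fun i => ?_)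
      · rw [Prod.fst_sum, PoissonTensor.toLin_eq]
        ext i
        simp [Matrix.mulVec, dotProduct, P, mul_comm]
      · rw [Prod.snd_sum]
        simp [covector_single, Pi.single_apply]
    rw [h1]
    exact Γ.carrier.sum_mem fun j _ => Γ.carrier.smul_mem _ (hX j)
  refine ⟨P, ?_⟩
  ext ⟨Y, ξ⟩
  rw [PoissonTensor.mem_graph]
  constructor
  · intro hY
    exact huniq (hP ξ) hY
  · intro hY
    rw [← show P.toLin ξ = Y from hY]
    exact hP ξ

variable (Γ : DiracStructure (Fin n → ℝ)) (I : Finset (Fin n))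

/-- An involution has the same image and preimage of a subspace. -/
theorem mem_sigma {x : (Fin n → ℝ) × Dual ℝ (Fin n → ℝ)} :
    x ∈ (sigma I Γ).carrier ↔ sigmaLin I x ∈ Γ.carrier := by
  constructor
  · rintro ⟨y, hy, rfl⟩
    change sigmaLin I (sigmaLin I y) ∈ _
    rwa [sigmaLin_involutive I y]
  · intro hx
    exact ⟨_, hx, sigmaLin_involutive I x⟩

theorem eq_zero_of_isCompl {p q : Submodule ℝ (Fin n → ℝ)} (h : IsCompl p q)
    {ξ : Dual ℝ (Fin n → ℝ)} (hp : ∀ X ∈ p, ξ X = 0) (hq : ∀ X ∈ q, ξ X = 0) : ξ = 0 := by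
  ext1 i
  refine LinearMap.ext_ring ?_
  obtain ⟨y, hy, z, hz, hyz⟩ :=
    Submodule.mem_sup.1 (h.sup_eq_top ▸ Submodule.mem_top : Pi.single i (1 : ℝ) ∈ p ⊔ q)
  change ξ (Pi.single i 1) = 0
  rw [← hyz, map_add, hp y hy, hq z hz, add_zero]

variable {Γ I}

/-- Both halves of complementarity are used: spanning kills the covector part of σ_I(Y, 0), and
disjointness then kills its vector part. -/
theorem charSubspace_sigma (h : IsCompl (coordSubspace Iᶜ) Γ.charSubspace) :
    (sigma I Γ).charSubspace = ⊥ := by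
  rw [eq_bot_iff]
  intro Y hY
  rw [DiracStructure.mem_charSubspace, mem_sigma] at hY
  have hξ : (sigmaLin I (Y, 0)).2 = 0 := by
    refine eq_zero_of_isCompl h (fun X hX => ?_) fun X hX => ?_
    · rw [dual_apply_eq_sum]
      refine Finset.sum_eq_zero fun i _ => ?_
      rw [sigmaLin_snd]
      split_ifs with hi
      · rw [apply_eq_zero_of_mem_coordSubspace hX (by simpa using hi), zero_mul]
      · exact mul_zero _
    -- Pairing with (X, 0) leaves only the value of the covector at X.
    · have := Γ.isotropic hY (Γ.mem_charSubspace.1 hX)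
      simpa using this
  have h1 : (sigmaLin I (Y, 0)).1 ∈ Γ.charSubspace := by
    rw [DiracStructure.mem_charSubspace]
    rwa [show sigmaLin I (Y, 0) = ((sigmaLin I (Y, 0)).1, 0) from Prod.ext rfl hξ] at hY
  have h2 : (sigmaLin I (Y, 0)).1 ∈ coordSubspace Iᶜ := by
    rw [mem_coordSubspace]
    intro i hi
    rw [sigmaLin_fst, if_pos (by simpa using hi)]
    rfl
  have h3 : (sigmaLin I (Y, 0)).1 = 0 := (Submodule.disjoint_def.1 h.disjoint) _ h2 h1
  have h4 : sigmaLin I (Y, 0) = 0 := Prod.ext h3 hξ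
  have h5 := sigmaLin_involutive I (Y, 0)
  rw [h4, map_zero] at h5
  exact (congrArg Prod.fst h5).symm

theorem existsUnique_isPoisson_sigma (h : IsCompl (coordSubspace Iᶜ) Γ.charSubspace) :
    ∃! P : PoissonTensor (Fin n), IsPoisson (sigma I Γ) P := by
  obtain ⟨P, hP⟩ := exists_isPoisson_of_charSubspace_eq_bot _ (charSubspace_sigma h)
  exact ⟨P, hP, fun Q hQ => PoissonTensor.eq_of_graph_eq (hQ.symm.trans hP)⟩

/-- The tool for computing Π: every element of Γ, once swapped by σ_I, gives one value of the linear
map Π. -/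
theorem toLin_eq_of_sigmaLin_mem {P : PoissonTensor (Fin n)} (hP : IsPoisson (sigma I Γ) P)
    {x : (Fin n → ℝ) × Dual ℝ (Fin n → ℝ)} (hx : x ∈ Γ.carrier) :
    P.toLin (sigmaLin I x).2 = (sigmaLin I x).1 := by
  rw [← PoissonTensor.mem_graph, ← hP, mem_sigma, sigmaLin_involutive I x]
  exact hx

/-! ### The blocks of the matrix of `σ_I(Γ)` -/

variable (I) in
/-- Extension by zero `ℝ^{I'} → ℝ^n`. -/
def extendZeroCompl (y : {i : Fin n // i ∉ I} → ℝ) (i : Fin n) : ℝ :=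
  if hi : i ∈ I then 0 else y ⟨i, hi⟩

theorem extendZeroCompl_dotProduct (y : {i : Fin n // i ∉ I} → ℝ) (z : Fin n → ℝ) :
    extendZeroCompl I y ⬝ᵥ z = y ⬝ᵥ fun i => z i := by
  rw [dotProduct, ← Fintype.sum_subtype_add_sum_subtype (· ∈ I)]
  have h1 : ∀ i : {i : Fin n // i ∈ I}, extendZeroCompl I y i = 0 := fun i => dif_pos i.2
  have h2 : ∀ i : {i : Fin n // i ∉ I}, extendZeroCompl I y i = y i := fun i => dif_neg i.2
  simp only [h1, h2, zero_mul, Finset.sum_const_zero, zero_add]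
  rfl

variable {P : PoissonTensor (Fin n)}

/-- The vector with I-part y and I'-part β(y) lies in C(Γ). Applying σ_I to it, paired with the zero
covector, turns y into a covector and leaves β(y) as the vector. This determines the columns indexed
by I. -/
theorem mulVec_extendZero (h : IsCompl (coordSubspace Iᶜ) Γ.charSubspace)
    (hP : IsPoisson (sigma I Γ) P) (y : {i : Fin n // i ∈ I} → ℝ) :
    P.matrix.mulVec (extendZero I y) = extendZeroCompl I (beta Γ I h y) := by
  set X : Fin n → ℝ := extendZero I y + extendZeroCompl I (beta Γ I h y) with hXdef
  have hX1 : ∀ i (hi : i ∈ I), X i = y ⟨i, hi⟩ := fun i hi => by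
    simp [hXdef, extendZero, extendZeroCompl, hi]
  have hX2 : ∀ i (hi : i ∉ I), X i = beta Γ I h y ⟨i, hi⟩ := fun i hi => by
    simp [hXdef, extendZero, extendZeroCompl, hi]
  have hX : X ∈ Γ.charSubspace := by
    rw [mem_charSubspace_iff_beta Γ I h]
    have : (fun i : {i : Fin n // i ∈ I} => X i) = y := funext fun i => hX1 i.1 i.2
    rw [this]
    exact funext fun i => hX2 i.1 i.2
  have h1 := toLin_eq_of_sigmaLin_mem hP (Γ.mem_charSubspace.1 hX)
  have h2 : (sigmaLin I (X, 0)).2 = covector (extendZero I y) := by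
    refine dual_ext fun i => ?_
    rw [sigmaLin_snd, covector_single]
    by_cases hi : i ∈ I
    · simp [hi, hX1, extendZero]
    · simp [hi, extendZero]
  rw [h2, PoissonTensor.toLin_covector] at h1
  rw [h1]
  ext i
  rw [sigmaLin_fst]
  by_cases hi : i ∈ I
  · simp [hi, extendZeroCompl]
  · simp [hi, hX2, extendZeroCompl]

theorem transverseCovector_mkQ (h : IsCompl (coordSubspace Iᶜ) Γ.charSubspace)
    (i : {i : Fin n // i ∉ I}) {X : Fin n → ℝ} (hX : X ∈ coordSubspace Iᶜ) :
    transverseCovector Γ I h i (Γ.charSubspace.mkQ X) = X i := by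
  have h1 := Submodule.quotientEquivOfIsCompl_apply_mk_right (p := Γ.charSubspace)
    (q := coordSubspace Iᶜ) h.symm ⟨X, hX⟩
  exact congrArg (fun Y : coordSubspace (n := n) Iᶜ => (Y : Fin n → ℝ) i) h1

/-- The j-th transverse covector has a partner X in ℝ^{I'}. After σ_I, its I-coordinates are
replaced by those of X, which vanish, so the covector becomes exactly f_j and the I'-part of the
vector is still X. -/
theorem matrix_apply_of_notMem (h : IsCompl (coordSubspace Iᶜ) Γ.charSubspace)
    (hP : IsPoisson (sigma I Γ) P) (i j : {i : Fin n // i ∉ I}) :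
    P.matrix i j = (transversePoisson Γ I h).matrix i j := by
  obtain ⟨X₀, hX₀⟩ := Γ.exists_mem_comp_mkQ (transverseCovector Γ I h j)
  -- A partner vector may be changed by any element of C(Γ), so it can be chosen in ℝ^{I'}.
  obtain ⟨X, hX, Z, hZ, hXZ⟩ := Submodule.mem_sup.1
    (h.sup_eq_top ▸ Submodule.mem_top : X₀ ∈ coordSubspace Iᶜ ⊔ Γ.charSubspace)
  have hXη : (X, transverseCovector Γ I h j ∘ₗ Γ.charSubspace.mkQ) ∈ Γ.carrier := by
    have := Γ.carrier.sub_mem hX₀ (Γ.mem_charSubspace.1 hZ)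
    rwa [Prod.mk_sub_mk, sub_zero, ← hXZ, add_sub_cancel_right] at this
  have h1 := toLin_eq_of_sigmaLin_mem hP hXη
  have h2 : (sigmaLin I (X, transverseCovector Γ I h j ∘ₗ Γ.charSubspace.mkQ)).2 =
      covector (Pi.single j.1 1) := by
    refine dual_ext fun k => ?_
    rw [sigmaLin_snd, covector_single]
    split_ifs with hk
    · rw [Pi.single_eq_of_ne (fun hkj : k = j.1 => j.2 (hkj ▸ hk))]
      exact apply_eq_zero_of_mem_coordSubspace hX (by simpa using hk)
    · rw [LinearMap.comp_apply, transverseCovector_mkQ h j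
        (Submodule.subset_span ⟨k, by simpa using hk, rfl⟩), Pi.single_comm]
  rw [P.matrix_eq_toLin, ← h2, h1, sigmaLin_fst, if_neg i.2]
  change X i = Γ.bivector (transverseCovector Γ I h i) (transverseCovector Γ I h j)
  rw [Γ.bivector_eq _ _ hXη, transverseCovector_mkQ h i hX]

end Linear

/-! ## The isomorphism -/

/-! ### The splitting ℤ^n = ℤ^{I'} ⊕ ℤ^I -/

section Lattice

variable {n : ℕ} (I : Finset (Fin n))

/-- Extension by zero `ℤ^I → ℤ^n`. -/
def latticeExtend : ({i : Fin n // i ∈ I} → ℤ) →+ (Fin n → ℤ) where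
  toFun m i := if hi : i ∈ I then m ⟨i, hi⟩ else 0
  map_zero' := by
    ext i
    simp
  map_add' m m' := by
    ext i
    by_cases hi : i ∈ I <;> simp [hi]

/-- Extension by zero `ℤ^{I'} → ℤ^n`. -/
def latticeExtendCompl : ({i : Fin n // i ∉ I} → ℤ) →+ (Fin n → ℤ) where
  toFun r i := if hi : i ∈ I then 0 else r ⟨i, hi⟩
  map_zero' := by
    ext i
    simp
  map_add' m m' := by
    ext i
    by_cases hi : i ∈ I <;> simp [hi]

/-- Restriction `ℤ^n → ℤ^I`. -/
def latticeRestrict : (Fin n → ℤ) →+ ({i : Fin n // i ∈ I} → ℤ) where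
  toFun r i := r i
  map_zero' := rfl
  map_add' _ _ := rfl

/-- Restriction `ℤ^n → ℤ^{I'}`. -/
def latticeRestrictCompl : (Fin n → ℤ) →+ ({i : Fin n // i ∉ I} → ℤ) where
  toFun r i := r i
  map_zero' := rfl
  map_add' _ _ := rfl

theorem latticeExtendCompl_add_latticeExtend (r : Fin n → ℤ) :
    latticeExtendCompl I (latticeRestrictCompl I r) + latticeExtend I (latticeRestrict I r) = r := by
  ext i
  by_cases hi : i ∈ I <;>
    simp [latticeExtendCompl, latticeRestrictCompl, latticeExtend, latticeRestrict, hi]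

theorem latticeRestrict_latticeExtend (m : {i : Fin n // i ∈ I} → ℤ) :
    latticeRestrict I (latticeExtend I m) = m :=
  funext fun i => dif_pos i.2

theorem latticeRestrictCompl_latticeExtend (m : {i : Fin n // i ∈ I} → ℤ) :
    latticeRestrictCompl I (latticeExtend I m) = 0 :=
  funext fun i => dif_neg i.2

theorem latticeRestrict_latticeExtendCompl (r : {i : Fin n // i ∉ I} → ℤ) :
    latticeRestrict I (latticeExtendCompl I r) = 0 :=
  funext fun i => dif_pos i.2

theorem latticeRestrictCompl_latticeExtendCompl (r : {i : Fin n // i ∉ I} → ℤ) :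
    latticeRestrictCompl I (latticeExtendCompl I r) = r :=
  funext fun i => dif_neg i.2

theorem cast_latticeExtend (m : {i : Fin n // i ∈ I} → ℤ) :
    (fun i => (latticeExtend I m i : ℝ)) = extendZero I fun i => (m i : ℝ) := by
  ext i
  by_cases hi : i ∈ I <;> simp [latticeExtend, extendZero, hi]

theorem cast_latticeExtendCompl (r : {i : Fin n // i ∉ I} → ℤ) :
    (fun i => (latticeExtendCompl I r i : ℝ)) = extendZeroCompl I fun i => (r i : ℝ) := by
  ext i
  by_cases hi : i ∈ I <;> simp [latticeExtendCompl, extendZeroCompl, hi]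

end Lattice

theorem PoissonTensor.form_neg_left {J : Type} [Fintype J] (P : PoissonTensor J) (r s : J → ℤ) :
    P.form (-r) s = -P.form r s := by
  have := P.form_add_left (-r) r s
  rw [neg_add_cancel, P.form_zero_left] at this
  linarith

theorem PoissonTensor.form_neg_right {J : Type} [Fintype J] (P : PoissonTensor J) (r s : J → ℤ) :
    P.form r (-s) = -P.form r s := by
  rw [← P.form_neg_neg, neg_neg, P.form_neg_left]

/-! ### The form of σ_I(Γ) on the lattice and the holonomy phases -/

section Form

variable {n : ℕ} {Γ : DiracStructure (Fin n → ℝ)} {I : Finset (Fin n)}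
variable (h : IsCompl (coordSubspace Iᶜ) Γ.charSubspace)
variable {P : PoissonTensor (Fin n)} (hP : IsPoisson (sigma I Γ) P)
include h hP

/-- Π maps ℝ^I into ℝ^{I'}, so the I×I block vanishes. Hence the e_m with m in ℤ^I multiply without
a twist. -/
theorem form_extend_extend (m m' : {i : Fin n // i ∈ I} → ℤ) :
    P.form (latticeExtend I m) (latticeExtend I m') = 0 := by
  rw [PoissonTensor.form, cast_latticeExtend, cast_latticeExtend, mulVec_extendZero h hP,
    dotProduct_comm, extendZeroCompl_dotProduct]
  refine Finset.sum_eq_zero fun i _ => ?_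
  change _ * extendZero I _ i.1 = 0
  rw [show extendZero I (fun i => (m i : ℝ)) i.1 = 0 from dif_neg i.2, mul_zero]

theorem form_extendCompl_extend (r : {i : Fin n // i ∉ I} → ℤ) (m : {i : Fin n // i ∈ I} → ℤ) :
    P.form (latticeExtendCompl I r) (latticeExtend I m) =
      ∑ i, (r i : ℝ) * beta Γ I h (fun j => (m j : ℝ)) i := by
  rw [PoissonTensor.form, cast_latticeExtend, cast_latticeExtendCompl, mulVec_extendZero h hP,
    extendZeroCompl_dotProduct]
  refine Finset.sum_congr rfl fun i _ => ?_
  congr 1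
  exact dif_neg i.2

theorem form_extendCompl_extendCompl (r s : {i : Fin n // i ∉ I} → ℤ) :
    P.form (latticeExtendCompl I r) (latticeExtendCompl I s) =
      (transversePoisson Γ I h).form r s := by
  rw [PoissonTensor.form, PoissonTensor.form, cast_latticeExtendCompl, cast_latticeExtendCompl,
    extendZeroCompl_dotProduct]
  congr 1
  ext i
  rw [Matrix.mulVec, dotProduct_comm, extendZeroCompl_dotProduct, Matrix.mulVec, dotProduct_comm]
  congr 1
  ext j
  exact matrix_apply_of_notMem h hP i j

/-- Of the four blocks, the I×I one is zero, and skewness rewrites the I×I' one as minus the I'×I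
one. -/
theorem form_eq (r s : Fin n → ℤ) :
    P.form r s =
      (transversePoisson Γ I h).form (latticeRestrictCompl I r) (latticeRestrictCompl I s) +
      P.form (latticeExtendCompl I (latticeRestrictCompl I r))
        (latticeExtend I (latticeRestrict I s)) -
      P.form (latticeExtendCompl I (latticeRestrictCompl I s))
        (latticeExtend I (latticeRestrict I r)) := by
  conv_lhs => rw [← latticeExtendCompl_add_latticeExtend I r,
    ← latticeExtendCompl_add_latticeExtend I s]
  rw [P.form_add_left, P.form_add_right, P.form_add_right, form_extend_extend h hP,
    form_extendCompl_extendCompl h hP,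
    P.form_swap (latticeExtendCompl I (latticeRestrictCompl I s))]
  ring

/-- The value of a character of `M` at a holonomy translation. -/
theorem mFourier_neg_holonomy (r : {i : Fin n // i ∉ I} → ℤ) (m : {i : Fin n // i ∈ I} → ℤ) :
    UnitAddTorus.mFourier r (-holonomy Γ I h m) =
      Complex.exp (-(2 * Real.pi * Complex.I *
        (P.form (latticeExtendCompl I r) (latticeExtend I m) : ℂ))) := by
  rw [form_extendCompl_extend h hP]
  simp only [UnitAddTorus.mFourier, ContinuousMap.coe_mk]
  push_cast
  rw [Finset.mul_sum, ← Finset.sum_neg_distrib, Complex.exp_sum]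
  refine Finset.prod_congr rfl fun i _ => ?_
  change fourier (r i) (-(((beta Γ I h (fun j => (m j : ℝ)) i : ℝ)) : UnitAddCircle)) = _
  -- The character of M is a product of characters of circles of period 1, each of the form e^{2πi k
  -- x}.
  rw [← AddCircle.coe_neg, fourier_coe_apply]
  congr 1
  push_cast
  ring

/-- Writing the translation phase through Π makes it comparable with the twists of 𝒜_Π. It has 2π
where a twist has π, because commuting two monomials produces a twist twice. -/
theorem holonomyAction_mono (m : {i : Fin n // i ∈ I} → ℤ) (r : {i : Fin n // i ∉ I} → ℤ)
    (a : ℂ) :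
    holonomyAction Γ I h (Multiplicative.ofAdd m) (toUniversal (FourierPoly.mono _ r a)) =
      toUniversal (FourierPoly.mono _ r (Complex.exp (-(2 * Real.pi * Complex.I *
        (P.form (latticeExtendCompl I r) (latticeExtend I m) : ℂ))) * a)) := by
  rw [← mFourier_neg_holonomy h hP, ← FourierPoly.translate_mono]
  exact universalMap_apply _ _

end Form

/-! ### The two mutually inverse homomorphisms -/

section Iso

variable {n : ℕ} {Γ : DiracStructure (Fin n → ℝ)} {I : Finset (Fin n)}
variable (h : IsCompl (coordSubspace Iᶜ) Γ.charSubspace)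
variable {P : PoissonTensor (Fin n)} (hP : IsPoisson (sigma I Γ) P)

/-- The ⋆-homomorphism `𝒜_{Π_{Γ,M}} → 𝒜_Π` induced by the inclusion `ℤ^{I'} → ℤ^n`. -/
def transverseMap : QuantumTorus (transversePoisson Γ I h) →⋆ₐ[ℂ] QuantumTorus P :=
  universalMap <| FourierPoly.lift (fun r => FourierPoly.mono P (latticeExtendCompl I r) 1)
    (by rw [map_zero, FourierPoly.one_def])
    (fun r s => by
      rw [FourierPoly.mono_mul_mono, FourierPoly.smul_mono, map_add, mul_one, mul_one, one_mul,
        PoissonTensor.twist, PoissonTensor.twist, form_extendCompl_extendCompl h hP])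
    (fun r => by rw [FourierPoly.star_mono, star_one, map_neg])

theorem transverseMap_mono (r : {i : Fin n // i ∉ I} → ℤ) (a : ℂ) :
    transverseMap h hP (toUniversal (FourierPoly.mono _ r a)) =
      toUniversal (FourierPoly.mono P (latticeExtendCompl I r) a) := by
  rw [transverseMap, universalMap_apply, FourierPoly.lift_mono, FourierPoly.smul_mono, mul_one]

/-- The representation `u_m ↦ e_{-m}` of the lattice `ℤ^I` in `𝒜_Π`. -/
def latticeUnitary : Multiplicative ({i : Fin n // i ∈ I} → ℤ) →* QuantumTorus P where
  -- The minus sign is forced: conjugation by e_m would translate by -β(m), conjugation by e_{-m}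
  -- translates by β(m).
  toFun g := toUniversal (FourierPoly.mono P (-latticeExtend I g.toAdd) 1)
  map_one' := by rw [toAdd_one, map_zero, neg_zero, ← FourierPoly.one_def, map_one]
  map_mul' g k := by
    rw [← map_mul, FourierPoly.mono_mul_mono, PoissonTensor.twist, PoissonTensor.form_neg_neg,
      form_extend_extend h hP, toAdd_mul, map_add, neg_add]
    simp

theorem latticeUnitary_apply (g : Multiplicative ({i : Fin n // i ∈ I} → ℤ)) :
    latticeUnitary h hP g =
      toUniversal (FourierPoly.mono P (-latticeExtend I g.toAdd) 1) := rfl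

/-- Both sides are additive and continuous in `a`, so monomials suffice; there the commutation phase
of e_{-m} and e_r equals the holonomy phase. -/
theorem latticeUnitary_covariant (g : Multiplicative ({i : Fin n // i ∈ I} → ℤ))
    (a : QuantumTorus (transversePoisson Γ I h)) :
    latticeUnitary h hP g * transverseMap h hP a =
      transverseMap h hP (holonomyAction Γ I h g a) * latticeUnitary h hP g := by
  have hc : Continuous (transverseMap h hP) := continuous_universalMap _
  refine dense_toUniversal.induction_on a ?_ fun f => ?_
  · exact isClosed_eq (continuous_const.mul hc)
      ((hc.comp (continuous_universalMap _)).mul continuous_const)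
  refine f.induction (by simp) (fun _ _ h₁ h₂ => ?_) fun r a => ?_
  · simp only [map_add, mul_add, add_mul, h₁, h₂]
  · have key := holonomyAction_mono h hP g.toAdd r a
    rw [ofAdd_toAdd] at key
    rw [key, transverseMap_mono, transverseMap_mono, latticeUnitary_apply, ← map_mul, ← map_mul,
      FourierPoly.mono_mul_mono, FourierPoly.mono_mul_mono, add_comm]
    have h1 : P.form (-latticeExtend I g.toAdd) (latticeExtendCompl I r) =
        P.form (latticeExtendCompl I r) (latticeExtend I g.toAdd) := by
      rw [P.form_neg_left, P.form_swap, neg_neg]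
    -- The product e_{-m} e_r carries e^{-πi Π(r, m)} and e_r e_{-m} carries e^{πi Π(r, m)}; the
    -- holonomy factor e^{-2πi Π(r, m)} makes up the difference.
    rw [PoissonTensor.twist, PoissonTensor.twist, h1, P.form_neg_right, one_mul, mul_one,
      mul_comm _ a, mul_assoc a, ← Complex.exp_add]
    congr 4
    push_cast
    ring

/-- The ⋆-homomorphism `𝒜_{Γ,M} → 𝒜_Π`. -/
def fromDiracAlgebra : DiracAlgebra Γ I h →⋆ₐ[ℂ] QuantumTorus P :=
  universalLift <| CrossedPoly.lift (transverseMap h hP) (latticeUnitary h hP)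
    (fun g => by
      rw [latticeUnitary_apply, latticeUnitary_apply, ← map_star, FourierPoly.star_mono, star_one,
        toAdd_inv, map_neg])
    (latticeUnitary_covariant h hP)

theorem fromDiracAlgebra_mono (g : Multiplicative ({i : Fin n // i ∈ I} → ℤ))
    (a : QuantumTorus (transversePoisson Γ I h)) :
    fromDiracAlgebra h hP (toUniversal (CrossedPoly.mono _ g a)) =
      transverseMap h hP a * latticeUnitary h hP g := by
  rw [fromDiracAlgebra, universalLift_apply, CrossedPoly.lift_mono]

/-- The phase `e^{π i Π(r', r'')}` in `e_r = e^{π i Π(r', r'')} e_{r'} e_{r''}`, where `r'` and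
`r''` are the components of `r` in `ℤ^{I'}` and `ℤ^I`. -/
def splitPhase (P : PoissonTensor (Fin n)) (I : Finset (Fin n)) (r : Fin n → ℤ) : ℂ :=
  Complex.exp (Real.pi * Complex.I * (P.form (latticeExtendCompl I (latticeRestrictCompl I r))
    (latticeExtend I (latticeRestrict I r)) : ℂ))

/-- The element `e_{r'} u_{-r''}` of the crossed product, with the phase that makes it correspond
to `e_r`. -/
def splitMono (P : PoissonTensor (Fin n)) (r : Fin n → ℤ) :
    CrossedPoly (holonomyAction Γ I h) :=
  CrossedPoly.mono _ (Multiplicative.ofAdd (-latticeRestrict I r))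
    (toUniversal (FourierPoly.mono _ (latticeRestrictCompl I r) (splitPhase P I r)))

include hP in
-- Moving u_{-r''} past e_{s'} costs e^{2πi Π(s', r'')}. On the other side the phase of r + s
-- contributes the cross terms Π(r', s'') + Π(s', r''), and `form_eq` expands the twist; the
-- exponents then agree.
theorem splitMono_mul (r s : Fin n → ℤ) :
    splitMono h P r * splitMono h P s = P.twist r s • splitMono h P (r + s) := by
  rw [splitMono, splitMono, splitMono, CrossedPoly.mono_mul_mono, holonomyAction_mono h hP,
    ← map_mul toUniversal, FourierPoly.mono_mul_mono, CrossedPoly.smul_mono, ← map_smul,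
    FourierPoly.smul_mono, map_add, map_add, neg_add, ofAdd_add]
  congr 3
  rw [splitPhase, splitPhase, splitPhase, PoissonTensor.twist, PoissonTensor.twist,
    form_eq h hP r s, map_neg, P.form_neg_right]
  simp only [map_add, P.form_add_left, P.form_add_right]
  simp only [← Complex.exp_add]
  congr 1
  push_cast
  ring

include hP in
-- Conjugation turns the phase into e^{-πi Π(r', r'')}, while the action of r'' on e_{-r'}
-- contributes e^{2πi Π(r', r'')}. The product is the phase of -r, which equals that of r.
theorem star_splitMono (r : Fin n → ℤ) : star (splitMono h P r) = splitMono h P (-r) := by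
  rw [splitMono, splitMono, CrossedPoly.star_mono, ← map_star, FourierPoly.star_mono, ← ofAdd_neg,
    holonomyAction_mono h hP]
  simp only [map_neg, neg_neg, splitPhase, P.form_neg_neg]
  congr 3
  rw [P.form_neg_left, Complex.star_def, ← Complex.exp_conj, ← Complex.exp_add]
  congr 1
  simp only [map_mul, Complex.conj_ofReal, Complex.conj_I]
  push_cast
  ring

theorem splitMono_zero : splitMono h P 0 = 1 := by
  rw [splitMono, splitPhase, CrossedPoly.one_def, map_zero, map_zero, map_zero, map_zero,
    P.form_zero_left, neg_zero, ofAdd_zero, Complex.ofReal_zero, mul_zero, Complex.exp_zero,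
    ← FourierPoly.one_def, map_one]

/-- The ⋆-homomorphism `𝒜_Π → 𝒜_{Γ,M}`. -/
def toDiracAlgebra : QuantumTorus P →⋆ₐ[ℂ] DiracAlgebra Γ I h :=
  universalMap <| FourierPoly.lift (splitMono h P) (splitMono_zero h) (splitMono_mul h hP)
    (star_splitMono h hP)

theorem toDiracAlgebra_mono (r : Fin n → ℤ) (a : ℂ) :
    toDiracAlgebra h hP (toUniversal (FourierPoly.mono P r a)) =
      toUniversal (a • splitMono h P r) := by
  rw [toDiracAlgebra, universalMap_apply, FourierPoly.lift_mono]

theorem fromDiracAlgebra_toDiracAlgebra (x : QuantumTorus P) :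
    fromDiracAlgebra h hP (toDiracAlgebra h hP x) = x := by
  refine dense_toUniversal.induction_on x ?_ fun f => ?_
  · exact isClosed_eq ((continuous_universalLift _).comp (continuous_universalMap _)) continuous_id
  refine f.induction (by simp) (fun _ _ h₁ h₂ => ?_) fun r a => ?_
  · simp only [map_add, h₁, h₂]
  -- The twist in e_{r'} e_{r''} = e^{-πi Π(r', r'')} e_r cancels the phase built into `splitMono`.
  rw [toDiracAlgebra_mono, map_smul, map_smul, splitMono, fromDiracAlgebra_mono,
    transverseMap_mono, latticeUnitary_apply, ← map_mul, ← map_smul, toAdd_ofAdd, map_neg, neg_neg,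
    FourierPoly.mono_mul_mono, latticeExtendCompl_add_latticeExtend, FourierPoly.smul_mono,
    splitPhase, PoissonTensor.twist, mul_one, ← Complex.exp_add, add_neg_cancel, Complex.exp_zero,
    mul_one]

theorem toDiracAlgebra_fromDiracAlgebra (x : DiracAlgebra Γ I h) :
    toDiracAlgebra h hP (fromDiracAlgebra h hP x) = x := by
  have hto : Continuous (toDiracAlgebra h hP) := continuous_universalMap _
  have hfrom : Continuous (fromDiracAlgebra h hP) := continuous_universalLift _
  refine dense_toUniversal.induction_on x ?_ fun y => ?_
  · exact isClosed_eq (hto.comp hfrom) continuous_id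
  refine y.induction (by simp) (fun _ _ h₁ h₂ => ?_) fun g a => ?_
  · simp only [map_add, h₁, h₂]
  -- A second density argument: the coefficient `a` itself lies in a completion and is approximated
  -- by finite Fourier series.
  refine dense_toUniversal.induction_on a ?_ fun f => ?_
  · exact isClosed_eq (hto.comp (hfrom.comp (CrossedPoly.continuous_toUniversal_mono g)))
      (CrossedPoly.continuous_toUniversal_mono g)
  refine f.induction ?_ (fun _ _ h₁ h₂ => ?_) fun r a => ?_
  · rw [map_zero, CrossedPoly.mono_zero, map_zero, map_zero, map_zero]
  · simp only [map_add, CrossedPoly.mono_add, h₁, h₂]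
  rw [fromDiracAlgebra_mono, transverseMap_mono, latticeUnitary_apply, ← map_mul,
    FourierPoly.mono_mul_mono, toDiracAlgebra_mono, splitMono, CrossedPoly.smul_mono, ← map_smul,
    FourierPoly.smul_mono, splitPhase, PoissonTensor.twist]
  -- The index here is r - m with r in ℤ^{I'} and m in ℤ^I, so its components are r and -m, and the
  -- twist and the phase are inverse to each other.
  simp only [map_add, map_neg, latticeRestrict_latticeExtend, latticeRestrictCompl_latticeExtend,
    latticeRestrict_latticeExtendCompl, latticeRestrictCompl_latticeExtendCompl, neg_zero, zero_add,
    add_zero, neg_neg, ofAdd_toAdd]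
  rw [mul_one, mul_assoc, ← Complex.exp_add, neg_add_cancel, Complex.exp_zero, mul_one]

end Iso

end DiracQuant

end

theorem mainTheorem4 (n : ℕ) (Γ : DiracQuant.DiracStructure (Fin n → ℝ)) (I : Finset (Fin n))
    (h : IsCompl (DiracQuant.coordSubspace Iᶜ) Γ.charSubspace) :
    (∃! P : DiracQuant.PoissonTensor (Fin n),
      DiracQuant.IsPoisson (DiracQuant.sigma I Γ) P) ∧
    ∀ P : DiracQuant.PoissonTensor (Fin n), DiracQuant.IsPoisson (DiracQuant.sigma I Γ) P →
      Nonempty (DiracQuant.DiracAlgebra Γ I h ≃⋆ₐ[ℂ] DiracQuant.QuantumTorus P) :=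
  ⟨DiracQuant.existsUnique_isPoisson_sigma h, fun _ hP =>
    ⟨StarAlgEquiv.ofBijective (DiracQuant.fromDiracAlgebra h hP)
      ⟨Function.LeftInverse.injective (DiracQuant.toDiracAlgebra_fromDiracAlgebra h hP),
        Function.RightInverse.surjective (DiracQuant.fromDiracAlgebra_toDiracAlgebra h hP)⟩⟩⟩
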